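/- **Model.** Let $L:[0,\infty)\to[0,\infty)$ be a (measurable) average channel gain such that $L(r)\le L_0:=L(0)$ for all $r\ge 0$, $0<\gamma:=\int_0^\infty rL(r)\,dr<\infty$ (a *physically feasible path loss*), and $L$ is right-continuous at $0$. Base stations with $N_t$ antennas form a homogeneous Poisson point process $\Phi_\lambda$ of intensity $\lambda$ in $\mathbb R^2$; a single-antenna user sits at the origin and is served by the closest base station, at distance $r_0=r_0(\lambda)$. Noise has power $\sigma^2\ge 0$, and $N_t=N_t(\lambda)\in\mathbb N$ is non-decreasing in $\lambda$ with $N_t(\lambda)\to\infty$. Let $h_{0,0}\in\mathbb C^{N_t}$ be the channel of the user to its serving base station and, for each other base station $i$ at distance $r_i>r_0$, let $h_{i,0},h_{i,i}\in\mathbb C^{N_t}$ be its channels to the user at the origin and to the user it serves. All entries are i.i.d. circularly symmetric complex Gaussian with mean $0$ and variance $1$, and independent of $\Phi_\lambda$. Base station $i$ uses the maximum ratio transmission precoder $p_i=h_{i,i}/\|h_{i,i}\|$. The conditional SINR is $$\mathrm{SINR}(\lambda)=\frac{L(r_0)\,|h_{0,0}^*p_0|^2}{\sum_{r_i\in\Phi_\lambda,\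 r_i>r_0}L(r_i)\,|h_{i,0}^*p_i|^2+\sigma^2},\qquad |h_{0,0}^*p_0|^2=\|h_{0,0}\|^2 .$$ All densities are realized on one probability space as follows. Base stations carry appearance levels, the pairs (location, level) form a Poisson process of unit intensity on $\mathbb R^2\times[0,\infty)$, and $\Phi_\lambda$ consists of the base stations with level at most $\lambda$. The vector $h_{0,0}$ consists of the first $N_t(\lambda)$ terms of one i.i.d. sequence. The power gain $g_i=|h_{i,0}^*p_i|^2$ of base station $i$, whose law (exponential with mean $1$) is the same for every number of antennas, does not change almost surely with the number of antennas; the gains of different base stations are independent. **Theorem 1.** Almost surely, $$\lim_{\lambda\to\infty}\frac{\lambda}{N_t(\lambda)}\,\mathrm{SINR}(\lambda)=\frac{L_0}{2\pi\gamma}.$$ In particular: 1. If $\lambda/N_t(\lambda)\to\infty$, then almost surely $\mathrm{SINR}(\lambda)\to 0$ and $\mathrm{SINR}(\lambda)\sim\frac{L_0}{2\pi\gamma}\left(\frac{\lambda}{N_t(\lambda)}\right)^{-1}$. 2. If $\lambda/N_t(\lambda)\to c\in(0,\infty)$, then almost surely $\mathrm{SINR}(\lambda)\to\frac{L_0}{2\pi\gamma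 c}$. 3. If $\lambda/N_t(\lambda)\to 0$, then almost surely $\mathrm{SINR}(\lambda)\to\infty$ and $\mathrm{SINR}(\lambda)\sim\frac{L_0}{2\pi\gamma}\,\frac{N_t(\lambda)}{\lambda}$. Suppose in addition that there are $\rho\ge 0$, $\zeta>0$, $\lambda_c\ge0$ and a differentiable decreasing $\tilde L:[\rho,\infty)\to(0,\infty)$ such that, for all $r\ge\rho$, $\tilde L(r)\le L(r)$ and $\frac{r\tilde L(r)}{-\tilde L'(r)}\ge\zeta$ (read as $r\tilde L(r)\ge-\zeta\tilde L'(r)$), and $\int_\rho^\infty\frac{r}{\tilde L(r)^2}e^{-\pi\lambda' r^2}dr<\infty$ for all $\lambda'>\lambda_c$. Then $\mathrm{SINR}(\lambda)$ is integrable for all sufficiently large $\lambda$, and $$\lim_{\lambda\to\infty}\mathbb E\left[\frac{\lambda}{N_t(\lambda)}\,\mathrm{SINR}(\lambda)\right]=\frac{L_0}{2\pi\gamma}.$$ -/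

import Mathlib

open Filter Topology MeasureTheory ProbabilityTheory Asymptotics
open scoped NNReal ENNReal

noncomputable section

namespace MISO

/-- Physically feasible path loss: `L : [0, ∞) → [0, ∞)` with `L r ≤ L 0 < ∞` and
`0 < ∫₀^∞ r L(r) dr < ∞`. Values of `L` at negative reals are irrelevant. -/
structure PhysicallyFeasible (L : ℝ → ℝ) : Prop where
  measurable : Measurable L
  nonneg : ∀ r, 0 ≤ r → 0 ≤ L r
  le_zero : ∀ r, 0 ≤ r → L r ≤ L 0
  integrable : IntegrableOn (fun r => r * L r) (Set.Ioi 0)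
  integral_pos : 0 < ∫ r in Set.Ioi (0 : ℝ), r * L r

/-- The constant `γ = ∫₀^∞ r L(r) dr`. -/
def gammaConst (L : ℝ → ℝ) : ℝ := ∫ r in Set.Ioi (0 : ℝ), r * L r

/-- The additional tail condition on the path loss. The minorant is required to be positive
because its square stands in the denominator of an integral that has to be finite, and the bound
`r L̃(r) / (-L̃'(r)) ≥ ζ` is written without the quotient, so that it holds where
`L̃'(r) = 0` (quotient `+∞`). -/
def TailCondition (L : ℝ → ℝ) : Prop :=
  ∃ r₀ : ℝ, 0 ≤ r₀ ∧ ∃ ζ : ℝ, 0 < ζ ∧ ∃ Lt : ℝ → ℝ,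
    DifferentiableOn ℝ Lt (Set.Ici r₀) ∧
    AntitoneOn Lt (Set.Ici r₀) ∧
    (∀ r ∈ Set.Ici r₀, 0 < Lt r) ∧
    (∀ r ∈ Set.Ici r₀, Lt r ≤ L r) ∧
    (∀ r ∈ Set.Ici r₀, ζ * (-derivWithin Lt (Set.Ici r₀) r) ≤ r * Lt r) ∧
    ∃ lamc : ℝ, 0 ≤ lamc ∧ ∀ lam : ℝ, lamc < lam →
      IntegrableOn (fun r => r / Lt r ^ 2 * Real.exp (-(Real.pi * lam * r ^ 2))) (Set.Ioi r₀)

/-- Circularly symmetric complex Gaussian law `CN(0, 1)`: independent real and imaginary parts,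
each centred Gaussian with variance `1 / 2`. -/
def complexGaussian : Measure ℂ :=
  ((gaussianReal 0 (1 / 2)).prod (gaussianReal 0 (1 / 2))).map fun p => (⟨p.1, p.2⟩ : ℂ)

/-- Law of a vector of `N` i.i.d. `CN(0, 1)` entries. -/
def complexGaussianVec (N : ℕ) : Measure (EuclideanSpace ℂ (Fin N)) :=
  (Measure.pi fun _ : Fin N => complexGaussian).map (WithLp.toLp 2)

/-- The random points `Z 0, Z 1, …` form a Poisson point process with intensity measure `μ`:
the number of points in a measurable set `B` with `μ B < ∞` is Poisson with mean `μ B`, and the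
numbers of points in pairwise disjoint such sets are independent. -/
structure IsPoissonProcess {Ω E : Type*} [MeasurableSpace Ω] [MeasurableSpace E]
    (Z : ℕ → Ω → E) (μ : Measure E) (P : Measure Ω) : Prop where
  measurable : ∀ i, Measurable (Z i)
  hasLaw_count : ∀ B : Set E, MeasurableSet B → μ B ≠ ∞ →
    HasLaw (fun ω => {i | Z i ω ∈ B}.encard)
      ((poissonMeasure (μ B).toNNReal).map (Nat.cast : ℕ → ℕ∞)) P
  indep_count : ∀ B : ℕ → Set E, (∀ n, MeasurableSet (B n)) → (∀ n, μ (B n) ≠ ∞) →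
    Pairwise (Function.onFun Disjoint B) →
    iIndepFun (fun n ω => {i | Z i ω ∈ B n}.encard) P

/-- Maximum ratio transmission: the unit-power precoder matched to the channel `h`. -/
def mrt {N : ℕ} (h : EuclideanSpace ℂ (Fin N)) : EuclideanSpace ℂ (Fin N) :=
  ((‖h‖⁻¹ : ℝ) : ℂ) • h

/-- Received power gain `|h^* p|²` of the precoder `p` over the channel `h`. -/
def gain {N : ℕ} (h p : EuclideanSpace ℂ (Fin N)) : ℝ := ‖inner ℂ h p‖ ^ 2

/-- A MISO downlink network, realized simultaneously for all densities `λ > 0` and all numbers of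
antennas, on one probability space.

* Base station `i` is at the point `X i` of the plane and is present at all densities `λ ≥ T i`.
  The pairs `(X i, T i)` form a Poisson process on `ℝ² × [0, ∞)` with Lebesgue intensity, so
  those present at density `λ` form a homogeneous Poisson point process of intensity `λ`, and
  densification adds an independent Poisson process of base stations.
* `f` lists the channels from the antennas of the serving base station to the tagged user: with
  `N` antennas the channel vector is `(f 0, …, f (N - 1))`.
* `hTag i N` and `hOwn i N` are the channel vectors, with `N` antennas, from base station `i` to
  the tagged user (when `i` interferes) and to the user that `i` serves.

All channel entries are i.i.d. `CN(0, 1)` and independent of the locations. The last field says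
how the interfering channels with different numbers of antennas live together: the scalar power
gain from an interfering base station through its MRT precoder, which has the same law for every
number of antennas, is not drawn anew when antennas are added. -/
structure Network {Ω : Type*} [MeasurableSpace Ω] (P : Measure Ω) where
  X : ℕ → Ω → EuclideanSpace ℝ (Fin 2)
  T : ℕ → Ω → ℝ
  f : ℕ → Ω → ℂ
  hTag : ℕ → (N : ℕ) → Ω → EuclideanSpace ℂ (Fin N)
  hOwn : ℕ → (N : ℕ) → Ω → EuclideanSpace ℂ (Fin N)
  poisson : IsPoissonProcess (fun i ω => (X i ω, T i ω))
    ((volume : Measure (EuclideanSpace ℝ (Fin 2))).prod (volume.restrict (Set.Ici (0 : ℝ)))) P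
  measurable_f : ∀ k, Measurable (f k)
  law_f : ∀ k, HasLaw (f k) complexGaussian P
  indep_f : iIndepFun f P
  measurable_hTag : ∀ i N, Measurable (hTag i N)
  measurable_hOwn : ∀ i N, Measurable (hOwn i N)
  law_h : ∀ i N, HasLaw (fun ω => (hTag i N ω, hOwn i N ω))
    ((complexGaussianVec N).prod (complexGaussianVec N)) P
  indep_h : iIndepFun (fun i ω => fun N : ℕ => (hTag i N ω, hOwn i N ω)) P
  indep_f_h : IndepFun (fun ω => fun k => f k ω)
    (fun ω => fun i => fun N : ℕ => (hTag i N ω, hOwn i N ω)) P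
  indep_geometry : IndepFun (fun ω => fun i => (X i ω, T i ω))
    (fun ω => ((fun k => f k ω), fun i => fun N : ℕ => (hTag i N ω, hOwn i N ω))) P
  gain_coupling : ∀ i N, 1 ≤ N → ∀ᵐ ω ∂P,
    gain (hTag i N ω) (mrt (hOwn i N ω)) = gain (hTag i 1 ω) (mrt (hOwn i 1 ω))

namespace Network

variable {Ω : Type*} [MeasurableSpace Ω] {P : Measure Ω} (net : Network P)

/-- Distance from the origin to the closest base station present at density `lam`. -/
def servingDist (lam : ℝ) (ω : Ω) : ℝ :=
  sInf ((fun i => ‖net.X i ω‖) '' {i | net.T i ω ≤ lam})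

/-- Base stations present at density `lam` that are farther than the serving one. -/
def interferers (lam : ℝ) (ω : Ω) : Set ℕ :=
  {i | net.T i ω ≤ lam ∧ net.servingDist lam ω < ‖net.X i ω‖}

/-- Channel vector of the serving base station with `N` antennas. -/
def hServ (N : ℕ) (ω : Ω) : EuclideanSpace ℂ (Fin N) :=
  WithLp.toLp 2 fun k : Fin N => net.f k ω

/-- Interference power at the tagged user. -/
def interference (L : ℝ → ℝ) (N : ℕ) (lam : ℝ) (ω : Ω) : ℝ :=
  ∑' i, (net.interferers lam ω).indicator
    (fun i => L ‖net.X i ω‖ * gain (net.hTag i N ω) (mrt (net.hOwn i N ω))) i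

/-- Conditional SINR of the tagged user at the origin, at density `lam`, with `N` antennas at each
base station and noise power `σ²`. -/
def sinr (L : ℝ → ℝ) (σ : ℝ) (N : ℕ) (lam : ℝ) (ω : Ω) : ℝ :=
  L (net.servingDist lam ω) * gain (net.hServ N ω) (mrt (net.hServ N ω)) /
    (net.interference L N lam ω + σ ^ 2)

end Network

end MISO

end

/-!
The normalized SINR is a quotient: the numerator is `L(r₀)` times the signal power per antenna
`‖h‖² / N`, the denominator is the interference plus noise divided by the density `lam`.

*Almost sure limit.* The signal power per antenna tends to `1` by the strong law of large numbers,
and `L(r₀) → L(0)` since the distance `r₀` to the serving base station tends to `0`. For the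
denominator, the sum `∑ φ(‖xᵢ‖) gᵢ` over all base stations present at density `lam` has mean and
variance linear in `lam`, by Campbell's formulas for the first two moments of a Poisson process
(`IsPoissonProcess.tsum_lintegral`, `IsPoissonProcess.tsum_tsum_lintegral`), which follow from the
law and the independence of the counts. Chebyshev's inequality along the squares and monotonicity in
`lam` give the law of large numbers `ae_tendsto_markedSum_div`. Applied to `φ = L` it bounds the
interference from above. Applied to `L` cut off inside the disc of radius `ε`, which contains the
serving base station as soon as `lam` is large, it bounds the interference from below; `ε → 0`
gives the limit `2πγ` (`Network.ae_tendsto_interferenceE_div`). Only the single-antenna law of the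
interfering gains is needed, since the gains do not change with the number of antennas.

*Expectations.* It is enough to bound the second moment of the normalized SINR uniformly for large
`lam` (`tendsto_integral_of_lintegral_sq_le`), that is, the mean of `(lam / I)²` for the
interference `I`. The tail condition forces `L(r) ≥ c exp(-a r²)` for large `r`
(`TailCondition.exists_gaussian_le`). If some base station is closer than `R` and `n ≥ 3` of them
lie in the annulus `[R, 2R)`, then all `n` interfere, and `I` is at least a lower bound of `L` on
the annulus times a sum of `n` independent exponential gains, whose inverse square has mean
`1 / ((n - 1) (n - 2))`. For a small fixed `R = R₀` the average of this over the Poisson variable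
`n` is of order `lam⁻²`. If this fails at the scales `R₀, …, R_j`, an event of probability
`O(exp (-lam R_j²))`, the scale `R_{j+1}` is used; for large `lam` the small probability outweighs
the factor `exp (8 a R_{j+1}²)` from the Gaussian minorant, and the sum over `j` is again
`O(lam⁻²)` (`Network.exists_lintegral_mul_inv_interferenceE_sq_le`).
-/

namespace MISO

/-! ### Moments of the Poisson distribution -/

theorem lintegral_poissonMeasure (r : ℝ≥0) (F : ℕ → ℝ≥0∞) :
    ∫⁻ n, F n ∂(poissonMeasure r) = ∑' n, F n * poissonMeasure r {n} :=
  lintegral_countable' F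

theorem succ_mul_poissonMeasure_succ (r : ℝ≥0) (n : ℕ) :
    ((n + 1 : ℕ) : ℝ≥0∞) * poissonMeasure r {n + 1} = r * poissonMeasure r {n} := by
  rw [poissonMeasure_singleton, poissonMeasure_singleton, ← ENNReal.ofReal_natCast,
    ← ENNReal.ofReal_coe_nnreal, ← ENNReal.ofReal_mul (by positivity),
    ← ENNReal.ofReal_mul (by positivity)]
  congr 1
  rw [Nat.factorial_succ]
  push_cast
  field_simp
  ring

/-- Size-biasing a Poisson variable shifts it by one. -/
theorem lintegral_natCast_mul_poissonMeasure (r : ℝ≥0) (F : ℕ → ℝ≥0∞) :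
    ∫⁻ n, (n : ℝ≥0∞) * F n ∂(poissonMeasure r) = r * ∫⁻ n, F (n + 1) ∂(poissonMeasure r) := by
  rw [lintegral_poissonMeasure, lintegral_poissonMeasure,
    tsum_eq_zero_add' ENNReal.summable, ← ENNReal.tsum_mul_left]
  simp only [Nat.cast_zero, zero_mul, zero_add]
  refine tsum_congr fun n => ?_
  rw [mul_right_comm, succ_mul_poissonMeasure_succ]
  ring

theorem lintegral_natCast_poissonMeasure (r : ℝ≥0) :
    ∫⁻ n, (n : ℝ≥0∞) ∂(poissonMeasure r) = r := by
  simpa using lintegral_natCast_mul_poissonMeasure r (fun _ => 1)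

theorem lintegral_natCast_sq_poissonMeasure (r : ℝ≥0) :
    ∫⁻ n, (n : ℝ≥0∞) * n ∂(poissonMeasure r) = r * r + r := by
  rw [lintegral_natCast_mul_poissonMeasure]
  simp only [Nat.cast_add, Nat.cast_one]
  rw [lintegral_add_right _ measurable_const, lintegral_natCast_poissonMeasure]
  simp [mul_add]

/-- A negative factorial moment of the Poisson distribution, with the order of decay in `r` that
makes `(r / (number of points))²` bounded in mean. -/
theorem lintegral_inv_poissonMeasure_le {r : ℝ≥0} (hr : r ≠ 0) :
    ∫⁻ n, ((((n + 1) * (n + 2) : ℕ) : ℝ≥0∞))⁻¹ ∂(poissonMeasure r) ≤ ((r : ℝ≥0∞) ^ 2)⁻¹ := by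
  have hr' : (r : ℝ≥0∞) ≠ 0 := by exact_mod_cast hr
  rw [ENNReal.le_inv_iff_mul_le, mul_comm, pow_two, mul_assoc]
  have h : ∀ n : ℕ, (r : ℝ≥0∞) * (r * ((((n + 1) * (n + 2) : ℕ) : ℝ≥0∞)⁻¹ *
      poissonMeasure r {n})) = poissonMeasure r {n + 2} := by
    intro n
    have h1 := succ_mul_poissonMeasure_succ r n
    have h2 := succ_mul_poissonMeasure_succ r (n + 1)
    have h3 : (((n + 1) * (n + 2) : ℕ) : ℝ≥0∞) * poissonMeasure r {n + 2} =
        r * (r * poissonMeasure r {n}) := by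
      rw [← h1, mul_left_comm, ← h2]
      push_cast
      ring
    calc _ = (((n + 1) * (n + 2) : ℕ) : ℝ≥0∞)⁻¹ * (r * (r * poissonMeasure r {n})) := by ring
      _ = _ := by
        rw [← h3, ← mul_assoc, ENNReal.inv_mul_cancel (by simp)
          (ENNReal.natCast_ne_top _), one_mul]
  rw [lintegral_poissonMeasure, ← ENNReal.tsum_mul_left, ← ENNReal.tsum_mul_left]
  simp_rw [h]
  have h1 : ∑' n, poissonMeasure r {n} = 1 := by
    simpa using (lintegral_poissonMeasure r (fun _ => 1)).symm
  rw [← h1]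
  exact ENNReal.tsum_comp_le_tsum_of_injective (add_left_injective 2) _

theorem poissonMeasure_le_two (r : ℝ≥0) :
    poissonMeasure r {n | n ≤ 2} ≤ ENNReal.ofReal (4 * Real.exp (-(r / 2))) := by
  have hset : {n : ℕ | n ≤ 2} = ({0} ∪ {1}) ∪ {2} := by ext n; simp; omega
  rw [hset]
  refine (measure_union_le _ _).trans ((add_le_add_left (measure_union_le _ _) _).trans ?_)
  rw [poissonMeasure_singleton, poissonMeasure_singleton, poissonMeasure_singleton,
    ← ENNReal.ofReal_add (by positivity) (by positivity),
    ← ENNReal.ofReal_add (by positivity) (by positivity)]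
  refine ENNReal.ofReal_le_ofReal ?_
  have h1 : Real.exp (-(r / 2 : ℝ)) = Real.exp (-r) * Real.exp (r / 2) := by
    rw [← Real.exp_add]; congr 1; ring
  have h2 := Real.quadratic_le_exp_of_nonneg (x := (r : ℝ) / 2) (by positivity)
  rw [h1]
  have h3 := Real.exp_pos (-(r : ℝ))
  have h4 : (0 : ℝ) ≤ r := r.2
  norm_num [Nat.factorial]
  nlinarith

theorem poissonMeasure_zero_le (r : ℝ≥0) :
    poissonMeasure r {0} ≤ ENNReal.ofReal (Real.exp (-(r / 2))) := by
  rw [poissonMeasure_singleton]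
  refine ENNReal.ofReal_le_ofReal ?_
  simp only [pow_zero, mul_one, Nat.factorial_zero, Nat.cast_one, div_one]
  exact Real.exp_le_exp.2 (by have : (0 : ℝ) ≤ r := r.2; linarith)

/-! ### Campbell's formulas for Poisson processes -/

/-- The number of indices `i` for which the point `z i` lies in `B`, as an extended nonnegative
real number. -/
noncomputable def pointCount {E : Type*} (B : Set E) (z : ℕ → E) : ℝ≥0∞ :=
  ∑' i, B.indicator 1 (z i)

section Count

variable {E : Type*} {Ω : Type*}

theorem pointCount_eq_encard (B : Set E) (z : ℕ → E) :
    pointCount B z = (({i | z i ∈ B}.encard : ℕ∞) : ℝ≥0∞) := by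
  rw [← ENNReal.tsum_set_one, tsum_subtype {i | z i ∈ B} fun _ => (1 : ℝ≥0∞)]
  rfl

theorem pointCount_union {A B : Set E} (h : Disjoint A B) (z : ℕ → E) :
    pointCount (A ∪ B) z = pointCount A z + pointCount B z := by
  unfold pointCount
  rw [← ENNReal.tsum_add, Set.indicator_union_of_disjoint h]

variable [MeasurableSpace E] [MeasurableSpace Ω]

theorem measurable_pointCount {B : Set E} (hB : MeasurableSet B) :
    Measurable (pointCount B : (ℕ → E) → ℝ≥0∞) :=
  Measurable.tsum fun i =>
    ((measurable_const (a := (1 : ℝ≥0∞))).indicator hB).comp (measurable_pi_apply i)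

variable {Z : ℕ → Ω → E} {μ : Measure E} {P : Measure Ω}

theorem IsPoissonProcess.lintegral_comp_pointCount (hZ : IsPoissonProcess Z μ P) {B : Set E}
    (hB : MeasurableSet B) (hμB : μ B ≠ ∞) {F : ℝ≥0∞ → ℝ≥0∞} (hF : Measurable F) :
    ∫⁻ ω, F (pointCount B fun i => Z i ω) ∂P =
      ∫⁻ n : ℕ, F n ∂(poissonMeasure (μ B).toNNReal) := by
  simp_rw [pointCount_eq_encard]
  have h := (hZ.hasLaw_count B hB hμB).lintegral_comp
    (f := fun n : ℕ∞ => F (n : ℝ≥0∞)) (hF.comp Measurable.of_discrete).aemeasurable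
  rw [h, lintegral_map (f := fun n : ℕ∞ => F (n : ℝ≥0∞)) (hF.comp Measurable.of_discrete)
    Measurable.of_discrete]
  simp

theorem IsPoissonProcess.measurable_apply (hZ : IsPoissonProcess Z μ P) :
    Measurable fun ω => fun i => Z i ω :=
  measurable_pi_lambda _ hZ.measurable

theorem IsPoissonProcess.lintegral_pointCount (hZ : IsPoissonProcess Z μ P) {B : Set E}
    (hB : MeasurableSet B) (hμB : μ B ≠ ∞) :
    ∫⁻ ω, pointCount B (fun i => Z i ω) ∂P = μ B := by
  rw [hZ.lintegral_comp_pointCount hB hμB (F := fun x => x) measurable_id]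
  simp [lintegral_natCast_poissonMeasure, ENNReal.coe_toNNReal hμB]

theorem IsPoissonProcess.lintegral_pointCount_sq (hZ : IsPoissonProcess Z μ P) {B : Set E}
    (hB : MeasurableSet B) (hμB : μ B ≠ ∞) :
    ∫⁻ ω, pointCount B (fun i => Z i ω) * pointCount B (fun i => Z i ω) ∂P =
      μ B * μ B + μ B := by
  rw [hZ.lintegral_comp_pointCount hB hμB (F := fun x => x * x) (by fun_prop)]
  simp [lintegral_natCast_sq_poissonMeasure, ENNReal.coe_toNNReal hμB]

theorem IsPoissonProcess.lintegral_pointCount_mul_of_disjoint (hZ : IsPoissonProcess Z μ P)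
    {A B : Set E} (hA : MeasurableSet A) (hB : MeasurableSet B) (hμA : μ A ≠ ∞) (hμB : μ B ≠ ∞)
    (hAB : Disjoint A B) :
    ∫⁻ ω, pointCount A (fun i => Z i ω) * pointCount B (fun i => Z i ω) ∂P = μ A * μ B := by
  let C : ℕ → Set E := fun n => if n = 0 then A else if n = 1 then B else ∅
  have hind := hZ.indep_count C
    (fun n => by dsimp only [C]; split_ifs <;> simp [hA, hB])
    (fun n => by dsimp only [C]; split_ifs <;> simp [hμA, hμB]) (by
      intro i j hij
      dsimp only [C, Function.onFun]
      split_ifs with h1 h2 h3 h4 h5 h6 <;> simp_all [disjoint_comm])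
  have h01 : IndepFun (fun ω => pointCount A fun i => Z i ω)
      (fun ω => pointCount B fun i => Z i ω) P := by
    simp_rw [pointCount_eq_encard]
    exact (hind.indepFun (i := 0) (j := 1) (by norm_num)).comp
      (φ := fun n : ℕ∞ => (n : ℝ≥0∞)) (ψ := fun n : ℕ∞ => (n : ℝ≥0∞))
      Measurable.of_discrete Measurable.of_discrete
  have := lintegral_mul_eq_lintegral_mul_lintegral_of_indepFun
    ((measurable_pointCount hA).comp hZ.measurable_apply)
    ((measurable_pointCount hB).comp hZ.measurable_apply) h01
  simp only [Pi.mul_apply, Function.comp_def] at this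
  rw [this, hZ.lintegral_pointCount hA hμA, hZ.lintegral_pointCount hB hμB]

theorem IsPoissonProcess.lintegral_pointCount_mul (hZ : IsPoissonProcess Z μ P)
    {A B : Set E} (hA : MeasurableSet A) (hB : MeasurableSet B) (hμA : μ A ≠ ∞) (hμB : μ B ≠ ∞) :
    ∫⁻ ω, pointCount A (fun i => Z i ω) * pointCount B (fun i => Z i ω) ∂P =
      μ A * μ B + μ (A ∩ B) := by
  have hfin : ∀ {S T : Set E}, S ⊆ T → μ T ≠ ∞ → μ S ≠ ∞ :=
    fun h hT => measure_ne_top_of_subset h hT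
  have hD := hA.inter hB
  have hA' := hA.diff hB
  have hB' := hB.diff hA
  have fD := hfin (Set.inter_subset_left (s := A) (t := B)) hμA
  have fA' := hfin (Set.sdiff_subset (s := A) (t := B)) hμA
  have fB' := hfin (Set.sdiff_subset (s := B) (t := A)) hμB
  have dA : Disjoint (A ∩ B) (A \ B) := Set.disjoint_sdiff_right.mono_left Set.inter_subset_right
  have dB : Disjoint (A ∩ B) (B \ A) := Set.disjoint_sdiff_right.mono_left Set.inter_subset_left
  have dAB : Disjoint (A \ B) (B \ A) := Set.disjoint_sdiff_right.mono_left Set.sdiff_subset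
  have eA : A = (A ∩ B) ∪ (A \ B) := (Set.inter_union_sdiff A B).symm
  have eB : B = (A ∩ B) ∪ (B \ A) := by rw [Set.inter_comm, Set.inter_union_sdiff]
  have cA : ∀ z : ℕ → E, pointCount A z = pointCount (A ∩ B) z + pointCount (A \ B) z := fun z => by
    conv_lhs => rw [eA]
    exact pointCount_union dA z
  have cB : ∀ z : ℕ → E, pointCount B z = pointCount (A ∩ B) z + pointCount (B \ A) z := fun z => by
    conv_lhs => rw [eB]
    exact pointCount_union dB z
  have mA : μ A = μ (A ∩ B) + μ (A \ B) := (measure_inter_add_sdiff A hB).symm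
  have mB : μ B = μ (A ∩ B) + μ (B \ A) := by
    rw [Set.inter_comm]; exact (measure_inter_add_sdiff B hA).symm
  have mes : ∀ {S : Set E}, MeasurableSet S → Measurable fun ω => pointCount S fun i => Z i ω :=
    fun hS => (measurable_pointCount hS).comp hZ.measurable_apply
  have mes2 : ∀ {S T : Set E}, MeasurableSet S → MeasurableSet T →
      Measurable fun ω => pointCount S (fun i => Z i ω) * pointCount T (fun i => Z i ω) :=
    fun hS hT => (mes hS).mul (mes hT)
  have expand : ∀ ω, pointCount A (fun i => Z i ω) * pointCount B (fun i => Z i ω) =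
      pointCount (A ∩ B) (fun i => Z i ω) * pointCount (A ∩ B) (fun i => Z i ω) +
      (pointCount (A ∩ B) (fun i => Z i ω) * pointCount (B \ A) (fun i => Z i ω) +
      (pointCount (A ∩ B) (fun i => Z i ω) * pointCount (A \ B) (fun i => Z i ω) +
      pointCount (A \ B) (fun i => Z i ω) * pointCount (B \ A) (fun i => Z i ω))) := by
    intro ω
    rw [cA, cB]
    ring
  simp_rw [expand]
  rw [lintegral_add_left (mes2 hD hD), lintegral_add_left (mes2 hD hB'),
    lintegral_add_left (mes2 hD hA'), hZ.lintegral_pointCount_sq hD fD,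
    hZ.lintegral_pointCount_mul_of_disjoint hD hB' fD fB' dB,
    hZ.lintegral_pointCount_mul_of_disjoint hD hA' fD fA' dA,
    hZ.lintegral_pointCount_mul_of_disjoint hA' hB' fA' fB' dAB, mA, mB]
  ring

theorem IsPoissonProcess.sum_map_eq [SigmaFinite μ] (hZ : IsPoissonProcess Z μ P) :
    Measure.sum (fun i => P.map (Z i)) = μ := by
  have key : ∀ B, MeasurableSet B → μ B ≠ ∞ → Measure.sum (fun i => P.map (Z i)) B = μ B := by
    intro B hB hμB
    rw [← hZ.lintegral_pointCount hB hμB, Measure.sum_apply _ hB]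
    have mi : ∀ i, Measurable fun ω => B.indicator (1 : E → ℝ≥0∞) (Z i ω) := fun i =>
      ((measurable_const (a := (1 : ℝ≥0∞))).indicator hB).comp (hZ.measurable i)
    unfold pointCount
    rw [lintegral_tsum fun i => (mi i).aemeasurable]
    refine tsum_congr fun i => ?_
    rw [Measure.map_apply (hZ.measurable i) hB, ← lintegral_indicator_one (hZ.measurable i hB)]
    rfl
  refine Measure.ext_of_iUnion_eq_univ (iUnion_spanningSets μ) fun n => ?_
  ext A hA
  rw [Measure.restrict_apply hA, Measure.restrict_apply hA]
  exact key _ (hA.inter (measurableSet_spanningSets μ n))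
    (measure_ne_top_of_subset Set.inter_subset_right (measure_spanningSets_lt_top μ n).ne)

/-- **Campbell's formula** for the mean of a sum over the points of a Poisson process. -/
theorem IsPoissonProcess.tsum_lintegral [SigmaFinite μ] (hZ : IsPoissonProcess Z μ P)
    {u : E → ℝ≥0∞} (hu : Measurable u) :
    ∑' i, ∫⁻ ω, u (Z i ω) ∂P = ∫⁻ x, u x ∂μ := by
  conv_rhs => rw [← hZ.sum_map_eq, lintegral_sum_measure]
  exact tsum_congr fun i => (lintegral_map hu (hZ.measurable i)).symm

/-- The second moment measure of a Poisson process is the product measure plus the intensity on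
the diagonal. -/
theorem IsPoissonProcess.sum_map_prod_eq [SigmaFinite μ] (hZ : IsPoissonProcess Z μ P) :
    Measure.sum (fun p : ℕ × ℕ => P.map fun ω => (Z p.1 ω, Z p.2 ω)) =
      μ.prod μ + μ.map (fun x => (x, x)) := by
  have hm : ∀ p : ℕ × ℕ, Measurable fun ω => (Z p.1 ω, Z p.2 ω) := fun p =>
    (hZ.measurable p.1).prodMk (hZ.measurable p.2)
  have hdiag : Measurable fun x : E => (x, x) := measurable_id.prodMk measurable_id
  have key : ∀ A B, MeasurableSet A → MeasurableSet B → μ A ≠ ∞ → μ B ≠ ∞ →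
      Measure.sum (fun p : ℕ × ℕ => P.map fun ω => (Z p.1 ω, Z p.2 ω)) (A ×ˢ B) =
      (μ.prod μ + μ.map (fun x => (x, x))) (A ×ˢ B) := by
    intro A B hA hB hμA hμB
    have mi : ∀ {S : Set E}, MeasurableSet S → ∀ i, Measurable fun ω =>
        S.indicator (1 : E → ℝ≥0∞) (Z i ω) := fun hS i =>
      ((measurable_const (a := (1 : ℝ≥0∞))).indicator hS).comp (hZ.measurable i)
    rw [Measure.add_apply, Measure.prod_prod, Measure.map_apply hdiag (hA.prod hB)]
    have h1 : (fun x : E => (x, x)) ⁻¹' A ×ˢ B = A ∩ B := by ext x; simp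
    rw [h1, ← hZ.lintegral_pointCount_mul hA hB hμA hμB, Measure.sum_apply _ (hA.prod hB)]
    have mij : ∀ i j, Measurable fun ω =>
        A.indicator (1 : E → ℝ≥0∞) (Z i ω) * B.indicator (1 : E → ℝ≥0∞) (Z j ω) := fun i j =>
      (mi hA i).mul (mi hB j)
    unfold pointCount
    simp_rw [← ENNReal.tsum_mul_right, ← ENNReal.tsum_mul_left]
    rw [lintegral_tsum fun i => (Measurable.tsum fun j => mij i j).aemeasurable, ENNReal.tsum_prod']
    refine tsum_congr fun i => ?_
    rw [lintegral_tsum fun j => (mij i j).aemeasurable]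
    refine tsum_congr fun j => ?_
    rw [Measure.map_apply (hm (i, j)) (hA.prod hB),
      ← lintegral_indicator_one (hm (i, j) (hA.prod hB))]
    refine lintegral_congr fun ω => ?_
    by_cases h2 : Z i ω ∈ A <;> by_cases h3 : Z j ω ∈ B <;> simp [Set.indicator, h2, h3]
  have hS : ⋃ n, spanningSets μ n ×ˢ spanningSets μ n = (Set.univ : Set (E × E)) := by
    rw [Set.iUnion_prod_of_monotone (monotone_spanningSets μ) (monotone_spanningSets μ),
      iUnion_spanningSets, Set.univ_prod_univ]
  refine Measure.ext_of_iUnion_eq_univ hS fun n => ?_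
  have hfin : μ (spanningSets μ n) ≠ ∞ := (measure_spanningSets_lt_top μ n).ne
  have hms := measurableSet_spanningSets μ n
  have : IsFiniteMeasure ((Measure.sum fun p : ℕ × ℕ => P.map fun ω => (Z p.1 ω, Z p.2 ω)).restrict
      (spanningSets μ n ×ˢ spanningSets μ n)) := by
    refine ⟨?_⟩
    rw [Measure.restrict_apply_univ, key _ _ hms hms hfin hfin, Measure.add_apply,
      Measure.prod_prod, Measure.map_apply hdiag (hms.prod hms)]
    refine ENNReal.add_lt_top.2 ⟨ENNReal.mul_lt_top hfin.lt_top hfin.lt_top, ?_⟩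
    exact (measure_mono (fun x hx => hx.1)).trans_lt hfin.lt_top
  refine Measure.ext_prod fun {s t} hs ht => ?_
  rw [Measure.restrict_apply (hs.prod ht), Measure.restrict_apply (hs.prod ht),
    Set.prod_inter_prod]
  exact key _ _ (hs.inter hms) (ht.inter hms)
    (measure_ne_top_of_subset Set.inter_subset_right hfin)
    (measure_ne_top_of_subset Set.inter_subset_right hfin)

/-- **Campbell's second moment formula**, as a double sum over the points. -/
theorem IsPoissonProcess.tsum_tsum_lintegral [SigmaFinite μ] (hZ : IsPoissonProcess Z μ P)
    {u : E → ℝ≥0∞} (hu : Measurable u) :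
    ∑' i, ∑' j, ∫⁻ ω, u (Z i ω) * u (Z j ω) ∂P = (∫⁻ x, u x ∂μ) ^ 2 + ∫⁻ x, u x ^ 2 ∂μ := by
  have hu2 : Measurable fun p : E × E => u p.1 * u p.2 :=
    (hu.comp measurable_fst).mul (hu.comp measurable_snd)
  have hdiag : Measurable fun x : E => (x, x) := measurable_id.prodMk measurable_id
  have h := congrArg (fun ν => ∫⁻ p, u p.1 * u p.2 ∂ν) hZ.sum_map_prod_eq
  simp only [lintegral_sum_measure] at h
  rw [ENNReal.tsum_prod', lintegral_add_measure, lintegral_map hu2 hdiag,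
    lintegral_prod_mul hu.aemeasurable hu.aemeasurable] at h
  simp_rw [pow_two]
  rw [← h]
  refine tsum_congr fun i => tsum_congr fun j => ?_
  rw [lintegral_map hu2 ((hZ.measurable i).prodMk (hZ.measurable j))]

end Count

/-! ### The law of large numbers for marked Poisson processes -/

theorem tendsto_div_atTop_of_sq {y : ℝ → ℝ} (hmono : Monotone y) (hnonneg : ∀ x, 0 ≤ y x) {m : ℝ}
    (h : Tendsto (fun n : ℕ => y (((n + 1 : ℕ) : ℝ) ^ 2) / ((n + 1 : ℕ) : ℝ) ^ 2) atTop (𝓝 m)) :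
    Tendsto (fun x => y x / x) atTop (𝓝 m) := by
  have h0 : Tendsto (fun n : ℕ => y ((n : ℝ) ^ 2) / (n : ℝ) ^ 2) atTop (𝓝 m) :=
    (tendsto_add_atTop_iff_nat (f := fun n : ℕ => y ((n : ℝ) ^ 2) / (n : ℝ) ^ 2) 1).1 h
  have hk : Tendsto (fun x : ℝ => ⌊√x⌋₊) atTop atTop :=
    tendsto_nat_floor_atTop.comp Real.tendsto_sqrt_atTop
  have hr : Tendsto (fun n : ℕ => ((n : ℝ) / (n + 1)) ^ 2) atTop (𝓝 1) := by
    simpa using (tendsto_natCast_div_add_atTop (1 : ℝ)).pow 2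
  have hlow := (h0.mul hr).comp hk
  have hup := (h.div hr one_ne_zero).comp hk
  simp only [mul_one, div_one] at hlow hup
  refine tendsto_of_tendsto_of_tendsto_of_le_of_le' hlow hup ?_ ?_
  · filter_upwards [eventually_ge_atTop (1 : ℝ)] with x hx
    have hs : (1 : ℝ) ≤ √x := Real.one_le_sqrt.2 hx
    have hf : (1 : ℝ) ≤ ⌊√x⌋₊ := by exact_mod_cast (Nat.one_le_floor_iff _).2 hs
    have h1 : (⌊√x⌋₊ : ℝ) ≤ √x := Nat.floor_le (by positivity)
    have h2 : √x < ⌊√x⌋₊ + 1 := Nat.lt_floor_add_one _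
    have h3 : √x ^ 2 = x := Real.sq_sqrt (by linarith)
    simp only [Function.comp_apply]
    set k : ℝ := (⌊√x⌋₊ : ℝ)
    have e : y (k ^ 2) / k ^ 2 * (k / (k + 1)) ^ 2 = y (k ^ 2) / (k + 1) ^ 2 := by field_simp
    rw [e]
    have h4 : k ^ 2 ≤ x := by rw [← h3]; gcongr
    have h5 : x ≤ (k + 1) ^ 2 := by rw [← h3]; gcongr
    exact div_le_div₀ (hnonneg _) (hmono h4) (by linarith) h5
  · filter_upwards [eventually_ge_atTop (1 : ℝ)] with x hx
    have hs : (1 : ℝ) ≤ √x := Real.one_le_sqrt.2 hx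
    have hf : (1 : ℝ) ≤ ⌊√x⌋₊ := by exact_mod_cast (Nat.one_le_floor_iff _).2 hs
    have h1 : (⌊√x⌋₊ : ℝ) ≤ √x := Nat.floor_le (by positivity)
    have h2 : √x < ⌊√x⌋₊ + 1 := Nat.lt_floor_add_one _
    have h3 : √x ^ 2 = x := Real.sq_sqrt (by linarith)
    simp only [Function.comp_apply, Pi.div_apply, Nat.cast_add, Nat.cast_one]
    set k : ℝ := (⌊√x⌋₊ : ℝ)
    have e : y ((k + 1) ^ 2) / (k + 1) ^ 2 / (k / (k + 1)) ^ 2 = y ((k + 1) ^ 2) / k ^ 2 := by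
      field_simp
    rw [e]
    have h4 : k ^ 2 ≤ x := by rw [← h3]; gcongr
    have h5 : x ≤ (k + 1) ^ 2 := by rw [← h3]; gcongr
    exact div_le_div₀ (hnonneg _) (hmono h5) (by positivity) h4

section Marked

variable {Ω E : Type*} [MeasurableSpace Ω] [MeasurableSpace E] {P : Measure Ω}

theorem ae_tendsto_zero_of_tsum_lintegral {f : ℕ → Ω → ℝ≥0∞} (hf : ∀ n, Measurable (f n))
    (h : ∑' n, ∫⁻ ω, f n ω ∂P ≠ ∞) : ∀ᵐ ω ∂P, Tendsto (fun n => f n ω) atTop (𝓝 0) := by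
  rw [← lintegral_tsum fun n => (hf n).aemeasurable] at h
  filter_upwards [ae_lt_top (Measurable.tsum hf) h] with ω hω
  exact ENNReal.tendsto_atTop_zero_of_tsum_ne_top hω.ne

theorem lintegral_sq_sub_le [IsProbabilityMeasure P] {Y : Ω → ℝ≥0∞} (hY : Measurable Y) {a : ℝ}
    (ha : 0 ≤ a) {V : ℝ≥0∞} (h1 : ∫⁻ ω, Y ω ∂P = ENNReal.ofReal a)
    (h2 : ∫⁻ ω, Y ω ^ 2 ∂P ≤ ENNReal.ofReal a ^ 2 + V) :
    ∫⁻ ω, ENNReal.ofReal (((Y ω).toReal - a) ^ 2) ∂P ≤ V := by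
  have hfin : ∀ᵐ ω ∂P, Y ω < ∞ := ae_lt_top hY (by rw [h1]; exact ENNReal.ofReal_ne_top)
  have key : ∫⁻ ω, (ENNReal.ofReal (((Y ω).toReal - a) ^ 2) + ENNReal.ofReal (2 * a) * Y ω) ∂P =
      ∫⁻ ω, (Y ω ^ 2 + ENNReal.ofReal a ^ 2) ∂P := by
    refine lintegral_congr_ae ?_
    filter_upwards [hfin] with ω hω
    obtain ⟨y, hy⟩ : ∃ y : ℝ≥0, Y ω = y := ⟨_, (ENNReal.coe_toNNReal hω.ne).symm⟩
    rw [hy, ENNReal.coe_toReal, ← ENNReal.ofReal_coe_nnreal, ← ENNReal.ofReal_mul (by positivity),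
      ← ENNReal.ofReal_pow (NNReal.coe_nonneg y), ← ENNReal.ofReal_pow ha,
      ← ENNReal.ofReal_add (by positivity) (by positivity),
      ← ENNReal.ofReal_add (by positivity) (by positivity)]
    congr 1
    ring
  rw [lintegral_add_right _ (hY.const_mul _), lintegral_const_mul _ hY, h1,
    lintegral_add_right _ measurable_const, lintegral_const, measure_univ, mul_one] at key
  have h3 : ∫⁻ ω, ENNReal.ofReal (((Y ω).toReal - a) ^ 2) ∂P + ENNReal.ofReal (2 * a ^ 2) ≤
      V + ENNReal.ofReal (2 * a ^ 2) := by
    calc _ = ∫⁻ ω, ENNReal.ofReal (((Y ω).toReal - a) ^ 2) ∂P +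
          ENNReal.ofReal (2 * a) * ENNReal.ofReal a := by
          rw [← ENNReal.ofReal_mul (by positivity)]
          congr 2
          ring
      _ = _ := key
      _ ≤ ENNReal.ofReal a ^ 2 + V + ENNReal.ofReal a ^ 2 := by gcongr
      _ = _ := by
        rw [add_right_comm, ← ENNReal.ofReal_pow ha, ← ENNReal.ofReal_add (by positivity)
          (by positivity), add_comm]
        congr 2
        ring
  exact (ENNReal.add_le_add_iff_right ENNReal.ofReal_ne_top).1 h3

/-- The sum `∑ᵢ u(zᵢ) gᵢ` of a function over the points `zᵢ`, weighted by the marks `gᵢ`. -/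
noncomputable def markedSum (u : E → ℝ≥0∞) (z : ℕ → E) (g : ℕ → ℝ≥0∞) : ℝ≥0∞ :=
  ∑' i, u (z i) * g i

theorem measurable_markedSum {u : E → ℝ≥0∞} (hu : Measurable u) :
    Measurable fun p : (ℕ → E) × (ℕ → ℝ≥0∞) => markedSum u p.1 p.2 :=
  Measurable.tsum fun i => (hu.comp ((measurable_pi_apply i).comp measurable_fst)).mul
    ((measurable_pi_apply i).comp measurable_snd)

variable {Z : ℕ → Ω → E} {μ : Measure E} {g : ℕ → Ω → ℝ≥0∞}

theorem measurable_markedSum_comp (hZ : Measurable fun ω i => Z i ω) (hg : ∀ i, Measurable (g i))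
    {u : E → ℝ≥0∞} (hu : Measurable u) :
    Measurable fun ω => markedSum u (fun i => Z i ω) (fun i => g i ω) :=
  (measurable_markedSum hu).comp (hZ.prodMk (measurable_pi_lambda _ hg))

theorem lintegral_markedSum [SigmaFinite μ] (hZ : IsPoissonProcess Z μ P)
    (hg : ∀ i, Measurable (g i)) (hZg : IndepFun (fun ω i => Z i ω) (fun ω i => g i ω) P)
    (hg1 : ∀ i, ∫⁻ ω, g i ω ∂P = 1) {u : E → ℝ≥0∞} (hu : Measurable u) :
    ∫⁻ ω, markedSum u (fun i => Z i ω) (fun i => g i ω) ∂P = ∫⁻ x, u x ∂μ := by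
  have hm : ∀ i, Measurable fun ω => u (Z i ω) := fun i => hu.comp (hZ.measurable i)
  have hm2 : ∀ i, Measurable fun ω => u (Z i ω) * g i ω := fun i => (hm i).mul (hg i)
  unfold markedSum
  rw [lintegral_tsum fun i => (hm2 i).aemeasurable, ← hZ.tsum_lintegral hu]
  refine tsum_congr fun i => ?_
  have hind : IndepFun (fun ω => u (Z i ω)) (g i) P :=
    hZg.comp (φ := fun z : ℕ → E => u (z i)) (ψ := fun γ : ℕ → ℝ≥0∞ => γ i)
      (hu.comp (measurable_pi_apply i))
      (measurable_pi_apply i)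
  have := lintegral_mul_eq_lintegral_mul_lintegral_of_indepFun (hm i) (hg i) hind
  simp only [Pi.mul_apply, hg1, mul_one] at this
  exact this

theorem lintegral_markedSum_sq_le [SigmaFinite μ] (hZ : IsPoissonProcess Z μ P)
    (hg : ∀ i, Measurable (g i)) (hZg : IndepFun (fun ω i => Z i ω) (fun ω i => g i ω) P)
    (hgi : iIndepFun g P) (hg1 : ∀ i, ∫⁻ ω, g i ω ∂P = 1) {κ : ℝ≥0∞}
    (hg2 : ∀ i, ∫⁻ ω, g i ω ^ 2 ∂P ≤ κ) {u : E → ℝ≥0∞} (hu : Measurable u) :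
    ∫⁻ ω, markedSum u (fun i => Z i ω) (fun i => g i ω) ^ 2 ∂P ≤
      (∫⁻ x, u x ∂μ) ^ 2 + (1 + κ) * ∫⁻ x, u x ^ 2 ∂μ := by
  have hm : ∀ i, Measurable fun ω => u (Z i ω) := fun i => hu.comp (hZ.measurable i)
  have hm2 : ∀ i j, Measurable fun ω => u (Z i ω) * g i ω * (u (Z j ω) * g j ω) := fun i j =>
    ((hm i).mul (hg i)).mul ((hm j).mul (hg j))
  have hgg : ∀ i j, ∫⁻ ω, g i ω * g j ω ∂P ≤ 1 + if j = i then κ else 0 := by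
    intro i j
    by_cases hij : i = j
    · subst hij
      simp only [if_true, ← pow_two]
      exact (hg2 i).trans le_add_self
    · have := lintegral_mul_eq_lintegral_mul_lintegral_of_indepFun (hg i) (hg j)
        (hgi.indepFun hij)
      simp only [Pi.mul_apply, hg1, mul_one] at this
      simp [this, Ne.symm hij]
  have hterm : ∀ i j, ∫⁻ ω, u (Z i ω) * g i ω * (u (Z j ω) * g j ω) ∂P ≤
      ∫⁻ ω, u (Z i ω) * u (Z j ω) ∂P +
        if j = i then κ * ∫⁻ ω, u (Z i ω) ^ 2 ∂P else 0 := by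
    intro i j
    have hind : IndepFun (fun ω => u (Z i ω) * u (Z j ω)) (fun ω => g i ω * g j ω) P :=
      hZg.comp (φ := fun z : ℕ → E => u (z i) * u (z j))
        (ψ := fun γ : ℕ → ℝ≥0∞ => γ i * γ j)
        ((hu.comp (measurable_pi_apply i)).mul (hu.comp (measurable_pi_apply j)))
        ((measurable_pi_apply i).mul (measurable_pi_apply j))
    have := lintegral_mul_eq_lintegral_mul_lintegral_of_indepFun ((hm i).mul (hm j))
      ((hg i).mul (hg j)) hind
    simp only [Pi.mul_apply] at this
    calc _ = ∫⁻ ω, u (Z i ω) * u (Z j ω) * (g i ω * g j ω) ∂P :=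
          lintegral_congr fun ω => by ring
      _ ≤ (∫⁻ ω, u (Z i ω) * u (Z j ω) ∂P) * (1 + if j = i then κ else 0) := by
        rw [this]
        gcongr
        exact hgg i j
      _ = _ := by
        by_cases hij : i = j
        · subst hij
          simp only [if_true, mul_add, mul_one, pow_two]
          rw [mul_comm κ]
        · simp [Ne.symm hij]
  calc _ = ∑' i, ∑' j, ∫⁻ ω, u (Z i ω) * g i ω * (u (Z j ω) * g j ω) ∂P := by
        unfold markedSum
        simp_rw [pow_two, ← ENNReal.tsum_mul_right, ← ENNReal.tsum_mul_left]
        rw [lintegral_tsum fun i => (Measurable.tsum fun j => hm2 i j).aemeasurable]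
        refine tsum_congr fun i => ?_
        rw [lintegral_tsum fun j => (hm2 i j).aemeasurable]
    _ ≤ ∑' i, ∑' j, (∫⁻ ω, u (Z i ω) * u (Z j ω) ∂P +
        if j = i then κ * ∫⁻ ω, u (Z i ω) ^ 2 ∂P else 0) :=
      ENNReal.tsum_le_tsum fun i => ENNReal.tsum_le_tsum fun j => hterm i j
    _ = _ := by
      simp_rw [ENNReal.tsum_add, tsum_ite_eq]
      rw [hZ.tsum_tsum_lintegral hu, ENNReal.tsum_mul_left,
        hZ.tsum_lintegral (u := fun x => u x ^ 2) (hu.pow_const 2)]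
      ring

end Marked

section LLN

variable {Ω F : Type*} [MeasurableSpace Ω] [MeasurableSpace F] {P : Measure Ω}

/-- The function `(x, t) ↦ φ x 𝟙{t ≤ lam}` on space and appearance level. -/
noncomputable def upToLevel (φ : F → ℝ≥0∞) (lam : ℝ) : F × ℝ → ℝ≥0∞ :=
  {q | q.2 ≤ lam}.indicator fun q => φ q.1

theorem measurable_upToLevel {φ : F → ℝ≥0∞} (hφ : Measurable φ) (lam : ℝ) :
    Measurable (upToLevel φ lam) :=
  (hφ.comp measurable_fst).indicator (measurableSet_le measurable_snd measurable_const)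

theorem lintegral_upToLevel {φ : F → ℝ≥0∞} (hφ : Measurable φ) {ν : Measure F} [SFinite ν]
    (lam : ℝ) :
    ∫⁻ q, upToLevel φ lam q ∂(ν.prod (volume.restrict (Set.Ici (0 : ℝ)))) =
      ENNReal.ofReal lam * ∫⁻ x, φ x ∂ν := by
  have h : upToLevel φ lam = fun q => φ q.1 * (Set.Iic lam).indicator 1 q.2 := by
    ext q
    by_cases hq : q.2 ≤ lam <;> simp [upToLevel, Set.indicator, hq]
  rw [h, lintegral_prod_mul (g := (Set.Iic lam).indicator 1) hφ.aemeasurable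
    ((measurable_const (a := (1 : ℝ≥0∞))).indicator measurableSet_Iic).aemeasurable,
    lintegral_indicator_one measurableSet_Iic, Measure.restrict_apply measurableSet_Iic, mul_comm]
  congr 1
  have : Set.Iic lam ∩ Set.Ici 0 = Set.Icc 0 lam := by rw [Set.inter_comm]; rfl
  rw [this, Real.volume_Icc, sub_zero]

theorem markedSum_upToLevel_mono {E : Type*} (φ : E → ℝ≥0∞) (z : ℕ → E × ℝ) (g : ℕ → ℝ≥0∞) :
    Monotone fun lam => markedSum (upToLevel φ lam) z g := by
  intro a b hab
  refine ENNReal.tsum_le_tsum fun i => mul_le_mul_left ?_ _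
  exact Set.indicator_le_indicator_of_subset (fun q hq => le_trans hq hab) (fun _ => zero_le) _

/-- The **law of large numbers** for the marked points with level at most `lam`, along the
continuous parameter `lam`. -/
theorem ae_tendsto_markedSum_div [IsProbabilityMeasure P] {ν : Measure F} [SigmaFinite ν]
    {Z : ℕ → Ω → F × ℝ} (hZ : IsPoissonProcess Z (ν.prod (volume.restrict (Set.Ici (0 : ℝ)))) P)
    {g : ℕ → Ω → ℝ≥0∞} (hg : ∀ i, Measurable (g i))
    (hZg : IndepFun (fun ω i => Z i ω) (fun ω i => g i ω) P)
    (hgi : iIndepFun g P) (hg1 : ∀ i, ∫⁻ ω, g i ω ∂P = 1) {κ : ℝ≥0∞} (hκ : κ ≠ ∞)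
    (hg2 : ∀ i, ∫⁻ ω, g i ω ^ 2 ∂P ≤ κ) {φ : F → ℝ≥0∞} (hφ : Measurable φ)
    (hφ1 : ∫⁻ x, φ x ∂ν ≠ ∞) (hφ2 : ∫⁻ x, φ x ^ 2 ∂ν ≠ ∞) :
    ∀ᵐ ω ∂P, (∀ lam, markedSum (upToLevel φ lam) (fun i => Z i ω) (fun i => g i ω) ≠ ∞) ∧
      Tendsto (fun lam => (markedSum (upToLevel φ lam) (fun i => Z i ω)
        (fun i => g i ω)).toReal / lam) atTop (𝓝 (∫⁻ x, φ x ∂ν).toReal) := by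
  set S : ℝ → Ω → ℝ≥0∞ := fun lam ω =>
    markedSum (upToLevel φ lam) (fun i => Z i ω) (fun i => g i ω) with hS
  set m : ℝ := (∫⁻ x, φ x ∂ν).toReal with hm
  have hm0 : 0 ≤ m := ENNReal.toReal_nonneg
  have hmE : ∫⁻ x, φ x ∂ν = ENNReal.ofReal m := (ENNReal.ofReal_toReal hφ1).symm
  have hSm : ∀ lam, Measurable (S lam) := fun lam =>
    measurable_markedSum_comp hZ.measurable_apply hg (measurable_upToLevel hφ lam)
  have hS1 : ∀ lam, 0 ≤ lam → ∫⁻ ω, S lam ω ∂P = ENNReal.ofReal (lam * m) := fun lam hlam => by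
    rw [hS, lintegral_markedSum hZ hg hZg hg1 (measurable_upToLevel hφ lam),
      lintegral_upToLevel hφ, hmE, ENNReal.ofReal_mul hlam]
  have hS2 : ∀ lam, 0 ≤ lam → ∫⁻ ω, S lam ω ^ 2 ∂P ≤
      ENNReal.ofReal (lam * m) ^ 2 + (1 + κ) * (ENNReal.ofReal lam * ∫⁻ x, φ x ^ 2 ∂ν) := by
    intro lam hlam
    refine (lintegral_markedSum_sq_le hZ hg hZg hgi hg1 hg2
      (measurable_upToLevel hφ lam)).trans (le_of_eq ?_)
    have hsq : ∀ q, upToLevel φ lam q ^ 2 = upToLevel (fun x => φ x ^ 2) lam q := fun q => by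
      by_cases hq : q.2 ≤ lam <;> simp [upToLevel, Set.indicator, hq]
    simp_rw [hsq]
    rw [lintegral_upToLevel hφ, lintegral_upToLevel (hφ.pow_const 2), hmE, ENNReal.ofReal_mul hlam]
  -- Along the squares the variances of the averages are summable.
  have hdev : ∀ n : ℕ, ∫⁻ ω, ENNReal.ofReal
      (((S (((n + 1 : ℕ) : ℝ) ^ 2) ω).toReal / ((n + 1 : ℕ) : ℝ) ^ 2 - m) ^ 2) ∂P ≤
      (1 + κ) * (∫⁻ x, φ x ^ 2 ∂ν) * ENNReal.ofReal (1 / ((n + 1 : ℕ) : ℝ) ^ 2) := by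
    intro n
    set l : ℝ := ((n + 1 : ℕ) : ℝ) ^ 2 with hl
    have hl0 : 0 < l := by positivity
    have h1 := lintegral_sq_sub_le (hSm l) (a := l * m) (by positivity) (hS1 l hl0.le)
      (hS2 l hl0.le)
    have h2 : ∀ ω, ENNReal.ofReal (((S l ω).toReal / l - m) ^ 2) =
        ENNReal.ofReal (1 / l ^ 2) * ENNReal.ofReal (((S l ω).toReal - l * m) ^ 2) := fun ω => by
      rw [← ENNReal.ofReal_mul (by positivity)]
      congr 1
      field_simp
    simp_rw [h2]
    rw [lintegral_const_mul _ (by have := hSm l; fun_prop)]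
    refine (mul_le_mul_right h1 _).trans (le_of_eq ?_)
    have h3 : ENNReal.ofReal (1 / l) = ENNReal.ofReal (1 / l ^ 2) * ENNReal.ofReal l := by
      rw [← ENNReal.ofReal_mul (by positivity)]
      congr 1
      field_simp
    rw [h3]
    ring
  have hsum : ∑' n : ℕ, ∫⁻ ω, ENNReal.ofReal
      (((S (((n + 1 : ℕ) : ℝ) ^ 2) ω).toReal / ((n + 1 : ℕ) : ℝ) ^ 2 - m) ^ 2) ∂P ≠ ∞ := by
    refine ne_top_of_le_ne_top ?_ (ENNReal.tsum_le_tsum hdev)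
    rw [ENNReal.tsum_mul_left]
    refine ENNReal.mul_ne_top (ENNReal.mul_ne_top (by simp [hκ]) hφ2) ?_
    have hsm : Summable fun n : ℕ => 1 / ((n + 1 : ℕ) : ℝ) ^ 2 :=
      (summable_nat_add_iff 1).2 (Real.summable_one_div_nat_pow.2 (by norm_num))
    rw [← ENNReal.ofReal_tsum_of_nonneg (fun n => by positivity) hsm]
    exact ENNReal.ofReal_ne_top
  have hfin : ∀ᵐ ω ∂P, ∀ n : ℕ, S n ω < ∞ := by
    rw [ae_all_iff]
    exact fun n => ae_lt_top (hSm n) (by rw [hS1 n (by positivity)]; exact ENNReal.ofReal_ne_top)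
  have hae := ae_tendsto_zero_of_tsum_lintegral
    (fun n => by have := hSm (((n + 1 : ℕ) : ℝ) ^ 2); fun_prop) hsum
  filter_upwards [hfin, hae] with ω hω1 hω2
  have hne : ∀ lam, S lam ω ≠ ∞ := by
    intro lam
    obtain ⟨n, hn⟩ := exists_nat_ge lam
    exact ne_top_of_le_ne_top (hω1 n).ne (markedSum_upToLevel_mono φ _ _ hn)
  refine ⟨hne, tendsto_div_atTop_of_sq (y := fun lam => (S lam ω).toReal) ?_
    (fun _ => ENNReal.toReal_nonneg) ?_⟩
  · intro a b hab
    exact ENNReal.toReal_mono (hne b) (markedSum_upToLevel_mono φ _ _ hab)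
  · have h1 := (ENNReal.tendsto_toReal ENNReal.zero_ne_top).comp hω2
    simp only [Function.comp_def, ENNReal.toReal_zero, ENNReal.toReal_ofReal (sq_nonneg _)] at h1
    rw [tendsto_iff_norm_sub_tendsto_zero]
    have h2 := h1.sqrt
    simpa only [Real.sqrt_sq_eq_abs, Real.sqrt_zero, Real.norm_eq_abs] using h2

end LLN

/-! ### Complex Gaussian channels -/

theorem measurable_complex_mk : Measurable fun p : ℝ × ℝ => (⟨p.1, p.2⟩ : ℂ) :=
  Complex.measurableEquivRealProd.symm.measurable

instance : IsProbabilityMeasure complexGaussian :=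
  Measure.isProbabilityMeasure_map measurable_complex_mk.aemeasurable

instance (N : ℕ) : IsProbabilityMeasure (complexGaussianVec N) :=
  Measure.isProbabilityMeasure_map (by fun_prop)

theorem lintegral_complexGaussian {F : ℂ → ℝ≥0∞} (hF : Measurable F) :
    ∫⁻ z, F z ∂complexGaussian = ∫⁻ p, F ⟨p.1, p.2⟩
      ∂((gaussianReal 0 (1 / 2)).prod (gaussianReal 0 (1 / 2))) :=
  lintegral_map hF measurable_complex_mk

theorem norm_mk_sq (p : ℝ × ℝ) : ‖(⟨p.1, p.2⟩ : ℂ)‖ ^ 2 = p.1 ^ 2 + p.2 ^ 2 := by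
  rw [Complex.sq_norm, Complex.normSq_mk]
  ring

theorem lintegral_sq_gaussianReal_half :
    ∫⁻ x, ENNReal.ofReal (x ^ 2) ∂(gaussianReal 0 (1 / 2)) = ENNReal.ofReal (1 / 2) := by
  have h2 : MemLp id 2 (gaussianReal 0 (1 / 2)) := by
    simpa using memLp_id_gaussianReal (μ := 0) (v := 1 / 2) 2
  have hv := variance_id_gaussianReal (μ := 0) (v := 1 / 2)
  rw [variance_eq_integral aemeasurable_id] at hv
  simp only [id_eq, integral_id_gaussianReal, sub_zero] at hv
  have hi : Integrable (fun x : ℝ => x ^ 2) (gaussianReal 0 (1 / 2)) := h2.integrable_sq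
  rw [← ofReal_integral_eq_lintegral_ofReal hi (ae_of_all _ fun x => sq_nonneg x), hv]
  norm_num

theorem lintegral_norm_sq_complexGaussian :
    ∫⁻ z, ENNReal.ofReal (‖z‖ ^ 2) ∂complexGaussian = 1 := by
  rw [lintegral_complexGaussian (by fun_prop)]
  simp_rw [norm_mk_sq, ENNReal.ofReal_add (sq_nonneg _) (sq_nonneg _)]
  have hm : Measurable fun x : ℝ => ENNReal.ofReal (x ^ 2) := by fun_prop
  rw [lintegral_add_left (by fun_prop), lintegral_prod _ (by fun_prop),
    lintegral_prod _ (by fun_prop)]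
  simp only [lintegral_const, measure_univ, mul_one, lintegral_sq_gaussianReal_half]
  rw [← ENNReal.ofReal_add (by norm_num) (by norm_num)]
  norm_num

/-- The second moment of the power `‖z‖²` of a complex Gaussian variable. -/
noncomputable def powerSecondMoment : ℝ≥0∞ := ∫⁻ z, ENNReal.ofReal (‖z‖ ^ 2) ^ 2 ∂complexGaussian

theorem powerSecondMoment_ne_top : powerSecondMoment ≠ ∞ := by
  have h4 : MemLp id 4 (gaussianReal 0 (1 / 2)) := by
    simpa using memLp_id_gaussianReal (μ := 0) (v := 1 / 2) 4
  have hfin : ∫⁻ x, ENNReal.ofReal (x ^ 4) ∂(gaussianReal 0 (1 / 2)) ≠ ∞ := by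
    have h := h4.integrable_norm_pow (p := 4) (by norm_num)
    simp only [id_eq, Real.norm_eq_abs] at h
    have h' : Integrable (fun x : ℝ => x ^ 4) (gaussianReal 0 (1 / 2)) := by
      refine h.congr (ae_of_all _ fun x => ?_)
      exact Even.pow_abs (by decide) x
    rw [← ofReal_integral_eq_lintegral_ofReal h' (ae_of_all _ fun x => by positivity)]
    exact ENNReal.ofReal_ne_top
  unfold powerSecondMoment
  rw [lintegral_complexGaussian (by fun_prop)]
  have hb : ∀ p : ℝ × ℝ, ENNReal.ofReal (‖(⟨p.1, p.2⟩ : ℂ)‖ ^ 2) ^ 2 ≤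
      2 * (ENNReal.ofReal (p.1 ^ 4) + ENNReal.ofReal (p.2 ^ 4)) := by
    intro p
    rw [norm_mk_sq, ← ENNReal.ofReal_pow (by positivity), ← ENNReal.ofReal_add (by positivity)
      (by positivity), ← ENNReal.ofReal_ofNat, ← ENNReal.ofReal_mul (by norm_num)]
    refine ENNReal.ofReal_le_ofReal ?_
    nlinarith [sq_nonneg (p.1 ^ 2 - p.2 ^ 2)]
  refine ne_top_of_le_ne_top ?_ (lintegral_mono hb)
  rw [lintegral_const_mul _ (by fun_prop), lintegral_add_left (by fun_prop),
    lintegral_prod _ (by fun_prop), lintegral_prod _ (by fun_prop)]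
  simp only [lintegral_const, measure_univ, mul_one]
  exact ENNReal.mul_ne_top (by norm_num) (ENNReal.add_ne_top.2 ⟨hfin, hfin⟩)

theorem lintegral_exp_neg_sq_gaussianReal_half {s : ℝ} (hs : 0 ≤ s) :
    ∫⁻ x, ENNReal.ofReal (Real.exp (-(s * x ^ 2))) ∂(gaussianReal 0 (1 / 2)) =
      ENNReal.ofReal (√(1 / (1 + s))) := by
  have hint : Integrable (fun x : ℝ => Real.exp (-(s * x ^ 2))) (gaussianReal 0 (1 / 2)) := by
    refine Integrable.of_bound (C := 1) (by fun_prop) (ae_of_all _ fun x => ?_)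
    rw [Real.norm_eq_abs, abs_of_pos (Real.exp_pos _)]
    exact Real.exp_le_one_iff.2 (by nlinarith [mul_nonneg hs (sq_nonneg x)])
  rw [← ofReal_integral_eq_lintegral_ofReal hint (ae_of_all _ fun x => (Real.exp_pos _).le)]
  congr 1
  rw [integral_gaussianReal_eq_integral_smul (by norm_num)]
  have h : ∀ x : ℝ, gaussianPDFReal 0 (1 / 2) x • Real.exp (-(s * x ^ 2)) =
      (√Real.pi)⁻¹ * Real.exp (-(1 + s) * x ^ 2) := by
    intro x
    unfold gaussianPDFReal
    have h1 : 2 * Real.pi * ((1 / 2 : ℝ≥0) : ℝ) = Real.pi := by push_cast; ring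
    rw [h1, smul_eq_mul, mul_assoc, ← Real.exp_add]
    congr 2
    push_cast
    ring
  simp_rw [h]
  rw [integral_const_mul, integral_gaussian, ← Real.sqrt_inv, ← Real.sqrt_mul (by positivity)]
  congr 1
  have := Real.pi_pos
  field_simp

/-- The Laplace transform of the power `‖z‖²`, which is exponential with mean `1`. -/
theorem lintegral_exp_neg_norm_sq_complexGaussian {s : ℝ} (hs : 0 ≤ s) :
    ∫⁻ z, ENNReal.ofReal (Real.exp (-(s * ‖z‖ ^ 2))) ∂complexGaussian =
      ENNReal.ofReal (1 / (1 + s)) := by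
  rw [lintegral_complexGaussian (by fun_prop)]
  simp_rw [norm_mk_sq, mul_add, neg_add, Real.exp_add, ENNReal.ofReal_mul (Real.exp_pos _).le]
  rw [lintegral_prod_mul (f := fun x : ℝ => ENNReal.ofReal (Real.exp (-(s * x ^ 2))))
    (g := fun x : ℝ => ENNReal.ofReal (Real.exp (-(s * x ^ 2)))) (by fun_prop) (by fun_prop),
    lintegral_exp_neg_sq_gaussianReal_half hs, ← ENNReal.ofReal_mul (by positivity),
    Real.mul_self_sqrt (by positivity)]

theorem complexGaussian_singleton_zero : complexGaussian {0} = 0 := by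
  have := nullSingletonClass_gaussianReal (μ := 0) (v := 1 / 2) (by norm_num)
  unfold complexGaussian
  rw [Measure.map_apply measurable_complex_mk (measurableSet_singleton 0)]
  have h : (fun p : ℝ × ℝ => (⟨p.1, p.2⟩ : ℂ)) ⁻¹' {0} ⊆ {0} ×ˢ {0} := by
    intro p hp
    have hp' : (⟨p.1, p.2⟩ : ℂ) = 0 := hp
    rw [Complex.ext_iff] at hp'
    exact ⟨hp'.1, hp'.2⟩
  refine measure_mono_null h ?_
  rw [Measure.prod_prod, measure_singleton, zero_mul]

theorem hasLaw_apply_complexGaussianVec {N : ℕ} (k : Fin N) :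
    HasLaw (fun h : EuclideanSpace ℂ (Fin N) => h k) complexGaussian (complexGaussianVec N) where
  aemeasurable := by fun_prop
  map_eq := by
    unfold complexGaussianVec
    rw [Measure.map_map (by fun_prop) (by fun_prop)]
    exact (measurePreserving_eval (fun _ : Fin N => complexGaussian) k).map_eq

theorem gain_mrt_self {N : ℕ} (h : EuclideanSpace ℂ (Fin N)) : gain h (mrt h) = ‖h‖ ^ 2 := by
  unfold gain mrt
  rw [inner_smul_right, inner_self_eq_norm_sq_to_K, norm_mul]
  by_cases h0 : ‖h‖ = 0
  · simp [h0]
  · have : ‖((‖h‖⁻¹ : ℝ) : ℂ)‖ = ‖h‖⁻¹ := by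
      rw [Complex.norm_real, norm_inv, norm_norm]
    rw [this]
    simp only [Complex.coe_algebraMap, norm_pow, Complex.norm_real, norm_norm]
    field_simp

/-- With a single antenna, precoding is a rotation of phase, and the gain is the channel power. -/
theorem gain_mrt_fin_one (h h' : EuclideanSpace ℂ (Fin 1)) (h0 : h' 0 ≠ 0) :
    gain h (mrt h') = ‖h 0‖ ^ 2 := by
  unfold gain mrt
  have hn : ‖h'‖ = ‖h' 0‖ := by simp [EuclideanSpace.norm_eq]
  have hn0 : ‖h' 0‖ ≠ 0 := norm_ne_zero_iff.2 h0
  rw [inner_smul_right, norm_mul, hn, Complex.norm_real, norm_inv, norm_norm]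
  simp only [PiLp.inner_apply, Finset.univ_unique, Fin.default_eq_zero, Finset.sum_singleton,
    RCLike.inner_apply, norm_mul, RCLike.norm_conj]
  field_simp

namespace Network

variable {Ω : Type*} [MeasurableSpace Ω] {P : Measure Ω} (net : Network P)

/-- The location and the appearance level of base station `i`. -/
def point (i : ℕ) (ω : Ω) : EuclideanSpace ℝ (Fin 2) × ℝ := (net.X i ω, net.T i ω)

/-- The power of the single-antenna channel from base station `i` to the tagged user. It is almost
surely the power gain of this interferer for every number of antennas. -/
noncomputable def powerGain (i : ℕ) (ω : Ω) : ℝ := ‖net.hTag i 1 ω 0‖ ^ 2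

theorem powerGain_nonneg (i : ℕ) (ω : Ω) : 0 ≤ net.powerGain i ω := sq_nonneg _

theorem measurable_powerGain (i : ℕ) : Measurable (net.powerGain i) := by
  have := net.measurable_hTag i 1
  unfold powerGain
  fun_prop

theorem hasLaw_hTag_apply (i : ℕ) :
    HasLaw (fun ω => net.hTag i 1 ω 0) complexGaussian P :=
  ((hasLaw_apply_complexGaussianVec 0).comp
    (measurePreserving_fst (μ := complexGaussianVec 1) (ν := complexGaussianVec 1)).hasLaw).comp
    (net.law_h i 1)

theorem hasLaw_hOwn_apply (i : ℕ) :
    HasLaw (fun ω => net.hOwn i 1 ω 0) complexGaussian P :=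
  ((hasLaw_apply_complexGaussianVec 0).comp
    (measurePreserving_snd (μ := complexGaussianVec 1) (ν := complexGaussianVec 1)).hasLaw).comp
    (net.law_h i 1)

theorem ae_gain_eq_powerGain :
    ∀ᵐ ω ∂P, ∀ i N, 1 ≤ N → gain (net.hTag i N ω) (mrt (net.hOwn i N ω)) = net.powerGain i ω := by
  rw [ae_all_iff]
  intro i
  rw [ae_all_iff]
  intro N
  have h0 : ∀ᵐ ω ∂P, net.hOwn i 1 ω 0 ≠ 0 := by
    have := (net.hasLaw_hOwn_apply i).measure_eq (p := fun z => z = 0) (measurableSet_singleton 0)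
    rw [ae_iff]
    simp only [ne_eq, not_not]
    rw [this]
    exact complexGaussian_singleton_zero
  by_cases hN : 1 ≤ N
  · filter_upwards [h0, net.gain_coupling i N hN] with ω h1 h2 _
    rw [h2, gain_mrt_fin_one _ _ h1]
    rfl
  · exact ae_of_all _ fun ω h => absurd h hN

theorem lintegral_powerGain (i : ℕ) : ∫⁻ ω, ENNReal.ofReal (net.powerGain i ω) ∂P = 1 := by
  rw [← lintegral_norm_sq_complexGaussian]
  exact (net.hasLaw_hTag_apply i).lintegral_comp (f := fun z => ENNReal.ofReal (‖z‖ ^ 2))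
    (by fun_prop)

theorem lintegral_powerGain_sq (i : ℕ) :
    ∫⁻ ω, ENNReal.ofReal (net.powerGain i ω) ^ 2 ∂P = powerSecondMoment :=
  (net.hasLaw_hTag_apply i).lintegral_comp (f := fun z => ENNReal.ofReal (‖z‖ ^ 2) ^ 2)
    (by fun_prop)

theorem lintegral_exp_neg_powerGain (i : ℕ) {s : ℝ} (hs : 0 ≤ s) :
    ∫⁻ ω, ENNReal.ofReal (Real.exp (-(s * net.powerGain i ω))) ∂P =
      ENNReal.ofReal (1 / (1 + s)) := by
  rw [← lintegral_exp_neg_norm_sq_complexGaussian hs]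
  exact (net.hasLaw_hTag_apply i).lintegral_comp
    (f := fun z => ENNReal.ofReal (Real.exp (-(s * ‖z‖ ^ 2)))) (by fun_prop)

/-- The measurable function that extracts the power gain from the channel vectors of a base
station. -/
noncomputable def gainOfChannels
    (h : (N : ℕ) → EuclideanSpace ℂ (Fin N) × EuclideanSpace ℂ (Fin N)) : ℝ :=
  ‖(h 1).1 0‖ ^ 2

theorem measurable_gainOfChannels : Measurable gainOfChannels := by
  unfold gainOfChannels
  fun_prop

theorem iIndepFun_powerGain : iIndepFun net.powerGain P :=
  net.indep_h.comp (fun _ => gainOfChannels) fun _ => measurable_gainOfChannels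

theorem measurable_gains_of_channels :
    Measurable fun h : ℕ → (N : ℕ) → EuclideanSpace ℂ (Fin N) × EuclideanSpace ℂ (Fin N) =>
      fun i => gainOfChannels (h i) :=
  measurable_pi_lambda _ fun i => measurable_gainOfChannels.comp (measurable_pi_apply i)

theorem indepFun_f_powerGain :
    IndepFun (fun ω k => net.f k ω) (fun ω i => net.powerGain i ω) P :=
  net.indep_f_h.comp (φ := id) measurable_id measurable_gains_of_channels

theorem indepFun_point_channels :
    IndepFun (fun ω i => net.point i ω)
      (fun ω => ((fun k => net.f k ω), fun i => net.powerGain i ω)) P :=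
  net.indep_geometry.comp (φ := id) measurable_id
    (measurable_fst.prodMk (measurable_gains_of_channels.comp measurable_snd))

theorem indepFun_point_powerGain :
    IndepFun (fun ω i => net.point i ω) (fun ω i => net.powerGain i ω) P :=
  net.indepFun_point_channels.comp (φ := id) measurable_id measurable_snd

end Network

/-! ### Mean interference -/

/-- The path loss at the point `x`, kept only at distances larger than `ε` from the origin. With
`ε < 0` all distances are kept. -/
noncomputable def farGain (L : ℝ → ℝ) (ε : ℝ) (x : EuclideanSpace ℝ (Fin 2)) : ℝ≥0∞ :=
  ENNReal.ofReal ((Set.Ioi ε).indicator L ‖x‖)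

/-- The integral of `r L(r)` over the distances `r > ε`; multiplied by `2π` it is the mean
interference per unit density from these distances. -/
noncomputable def farConst (L : ℝ → ℝ) (ε : ℝ) : ℝ :=
  ∫ r in Set.Ioi (0 : ℝ), r * (Set.Ioi ε).indicator L r

theorem farConst_of_neg (L : ℝ → ℝ) {ε : ℝ} (hε : ε < 0) : farConst L ε = gammaConst L := by
  unfold farConst gammaConst
  refine setIntegral_congr_fun measurableSet_Ioi fun r hr => ?_
  have : r ∈ Set.Ioi ε := lt_trans hε hr
  simp [this]

namespace PhysicallyFeasible

variable {L : ℝ → ℝ}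

theorem gammaConst_pos (hL : PhysicallyFeasible L) : 0 < gammaConst L := hL.integral_pos

theorem zero_pos (hL : PhysicallyFeasible L) : 0 < L 0 := by
  by_contra h
  have h0 : ∀ r ∈ Set.Ioi (0 : ℝ), r * L r = 0 := fun r hr => by
    have h1 := hL.nonneg r (le_of_lt hr)
    have h2 := hL.le_zero r (le_of_lt hr)
    have : L r = 0 := by linarith
    rw [this, mul_zero]
  have := hL.integral_pos
  rw [setIntegral_congr_fun measurableSet_Ioi h0] at this
  simp at this

theorem measurable_farGain (hL : PhysicallyFeasible L) (ε : ℝ) : Measurable (farGain L ε) :=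
  ((hL.measurable.indicator measurableSet_Ioi).comp measurable_norm).ennreal_ofReal

theorem indicator_nonneg (hL : PhysicallyFeasible L) (ε : ℝ) {r : ℝ} (hr : 0 ≤ r) :
    0 ≤ (Set.Ioi ε).indicator L r :=
  Set.indicator_apply_nonneg fun _ => hL.nonneg r hr

theorem indicator_le (hL : PhysicallyFeasible L) (ε : ℝ) {r : ℝ} (hr : 0 ≤ r) :
    (Set.Ioi ε).indicator L r ≤ L r :=
  Set.indicator_apply_le' (fun _ => le_rfl) fun _ => hL.nonneg r hr

theorem integrableOn_indicator (hL : PhysicallyFeasible L) (ε : ℝ) :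
    IntegrableOn (fun r => r * (Set.Ioi ε).indicator L r) (Set.Ioi 0) := by
  refine Integrable.mono' hL.integrable ?_ ?_
  · exact (measurable_id.mul (hL.measurable.indicator measurableSet_Ioi)).aestronglyMeasurable
  · refine (ae_restrict_iff' measurableSet_Ioi).2 (ae_of_all _ fun r hr => ?_)
    have hr' : (0 : ℝ) ≤ r := le_of_lt hr
    rw [Real.norm_eq_abs, abs_of_nonneg (mul_nonneg hr' (hL.indicator_nonneg ε hr'))]
    exact mul_le_mul_of_nonneg_left (hL.indicator_le ε hr') hr'

theorem farConst_nonneg (hL : PhysicallyFeasible L) (ε : ℝ) : 0 ≤ farConst L ε :=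
  setIntegral_nonneg measurableSet_Ioi fun _ hr =>
    mul_nonneg (le_of_lt hr) (hL.indicator_nonneg ε (le_of_lt hr))

/-- Integration in polar coordinates. -/
theorem lintegral_farGain (hL : PhysicallyFeasible L) (ε : ℝ) :
    ∫⁻ x, farGain L ε x = ENNReal.ofReal (2 * Real.pi * farConst L ε) := by
  have hfin : Module.finrank ℝ (EuclideanSpace ℝ (Fin 2)) = 2 := by simp
  have hint : Integrable fun x : EuclideanSpace ℝ (Fin 2) => (Set.Ioi ε).indicator L ‖x‖ := by
    rw [integrable_fun_norm_addHaar volume (f := (Set.Ioi ε).indicator L), hfin]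
    simpa using hL.integrableOn_indicator ε
  unfold farGain farConst
  rw [← ofReal_integral_eq_lintegral_ofReal hint
    (ae_of_all _ fun x => hL.indicator_nonneg ε (norm_nonneg x)),
    integral_fun_norm_addHaar volume ((Set.Ioi ε).indicator L), hfin]
  have hball : (volume : Measure (EuclideanSpace ℝ (Fin 2))).real (Metric.ball 0 1) = Real.pi := by
    rw [measureReal_def, EuclideanSpace.volume_ball_fin_two]
    simp [Real.pi_pos.le]
  rw [hball]
  simp only [nsmul_eq_mul, smul_eq_mul, Nat.cast_ofNat, Nat.add_one_sub_one, pow_one, mul_assoc]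

theorem lintegral_farGain_sq_ne_top (hL : PhysicallyFeasible L) (ε : ℝ) :
    ∫⁻ x, farGain L ε x ^ 2 ≠ ∞ := by
  have hb : ∀ x, farGain L ε x ^ 2 ≤ ENNReal.ofReal (L 0) * farGain L ε x := fun x => by
    rw [pow_two]
    refine mul_le_mul_left (ENNReal.ofReal_le_ofReal ?_) _
    exact (hL.indicator_le ε (norm_nonneg x)).trans (hL.le_zero _ (norm_nonneg x))
  refine ne_top_of_le_ne_top ?_ (lintegral_mono hb)
  rw [lintegral_const_mul _ (hL.measurable_farGain ε), hL.lintegral_farGain]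
  exact ENNReal.mul_ne_top ENNReal.ofReal_ne_top ENNReal.ofReal_ne_top

theorem tendsto_farConst (hL : PhysicallyFeasible L) :
    Tendsto (fun n : ℕ => farConst L (1 / ((n : ℝ) + 1))) atTop (𝓝 (gammaConst L)) := by
  refine tendsto_integral_filter_of_dominated_convergence (fun r => r * L r)
    (Eventually.of_forall fun n => (hL.integrableOn_indicator _).aestronglyMeasurable)
    (Eventually.of_forall fun n => ?_) hL.integrable ?_
  · refine (ae_restrict_iff' measurableSet_Ioi).2 (ae_of_all _ fun r hr => ?_)
    have hr' : (0 : ℝ) ≤ r := le_of_lt hr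
    rw [Real.norm_eq_abs, abs_of_nonneg (mul_nonneg hr' (hL.indicator_nonneg _ hr'))]
    exact mul_le_mul_of_nonneg_left (hL.indicator_le _ hr') hr'
  · refine (ae_restrict_iff' measurableSet_Ioi).2 (ae_of_all _ fun r hr => ?_)
    refine tendsto_const_nhds.congr' ?_
    filter_upwards [(tendsto_one_div_add_atTop_nhds_zero_nat (𝕜 := ℝ)).eventually
      (gt_mem_nhds (show (0 : ℝ) < r from hr))] with n hn
    rw [Set.indicator_of_mem (show r ∈ Set.Ioi (1 / ((n : ℝ) + 1)) from hn)]

end PhysicallyFeasible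

/-! ### Almost sure limits -/

namespace Network

variable {Ω : Type*} [MeasurableSpace Ω] {P : Measure Ω} (net : Network P)

theorem isPoissonProcess_point : IsPoissonProcess net.point
    ((volume : Measure (EuclideanSpace ℝ (Fin 2))).prod (volume.restrict (Set.Ici (0 : ℝ)))) P :=
  net.poisson

theorem ae_tendsto_markedSum_point [IsProbabilityMeasure P] {φ : EuclideanSpace ℝ (Fin 2) → ℝ≥0∞}
    (hφ : Measurable φ) (hφ1 : ∫⁻ x, φ x ≠ ∞) (hφ2 : ∫⁻ x, φ x ^ 2 ≠ ∞) :
    ∀ᵐ ω ∂P, (∀ lam, markedSum (upToLevel φ lam) (fun i => net.point i ω)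
        (fun i => ENNReal.ofReal (net.powerGain i ω)) ≠ ∞) ∧
      Tendsto (fun lam => (markedSum (upToLevel φ lam) (fun i => net.point i ω)
        (fun i => ENNReal.ofReal (net.powerGain i ω))).toReal / lam) atTop
        (𝓝 (∫⁻ x, φ x).toReal) :=
  ae_tendsto_markedSum_div net.isPoissonProcess_point
    (fun i => (net.measurable_powerGain i).ennreal_ofReal)
    (net.indepFun_point_powerGain.comp (φ := id)
      (ψ := fun (h : ℕ → ℝ) i => ENNReal.ofReal (h i)) measurable_id (by fun_prop))
    (net.iIndepFun_powerGain.comp (fun _ => ENNReal.ofReal) fun _ => ENNReal.measurable_ofReal)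
    net.lintegral_powerGain powerSecondMoment_ne_top
    (fun i => (net.lintegral_powerGain_sq i).le) hφ hφ1 hφ2

/-- The points accumulate at the origin: otherwise the law of large numbers would fail for the
indicator of a small ball. -/
theorem ae_exists_norm_lt [IsProbabilityMeasure P] :
    ∀ᵐ ω ∂P, ∀ ε : ℝ, 0 < ε → ∃ i, ‖net.X i ω‖ < ε := by
  have h : ∀ n : ℕ, ∀ᵐ ω ∂P, ∃ i, ‖net.X i ω‖ < 1 / ((n : ℝ) + 1) := by
    intro n
    set B : Set (EuclideanSpace ℝ (Fin 2)) := Metric.ball 0 (1 / ((n : ℝ) + 1)) with hB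
    have hvol : volume B ≠ ∞ := measure_ball_lt_top.ne
    have hvol0 : volume B ≠ 0 := (Metric.measure_ball_pos _ _ (by positivity)).ne'
    have h1 : ∫⁻ x, B.indicator (1 : EuclideanSpace ℝ (Fin 2) → ℝ≥0∞) x = volume B :=
      lintegral_indicator_one measurableSet_ball
    have h2 : ∀ x, B.indicator (1 : EuclideanSpace ℝ (Fin 2) → ℝ≥0∞) x ^ 2 =
        B.indicator (1 : EuclideanSpace ℝ (Fin 2) → ℝ≥0∞) x := fun x => by
      by_cases hx : x ∈ B <;> simp [hx]
    filter_upwards [net.ae_tendsto_markedSum_point (φ := B.indicator 1)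
      (measurable_const.indicator measurableSet_ball) (by rwa [h1])
      (by simp_rw [h2]; rwa [h1])] with ω hω
    by_contra hcon
    push Not at hcon
    have hz : ∀ lam, markedSum (upToLevel (B.indicator 1) lam) (fun i => net.point i ω)
        (fun i => ENNReal.ofReal (net.powerGain i ω)) = 0 := by
      intro lam
      refine ENNReal.tsum_eq_zero.2 fun i => ?_
      have : net.X i ω ∉ B := fun hi => by
        rw [hB, mem_ball_zero_iff] at hi
        exact absurd hi (not_lt.2 (hcon i))
      simp [upToLevel, point, Set.indicator, this]
    have h3 := hω.2
    simp_rw [hz] at h3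
    simp only [ENNReal.toReal_zero, zero_div, h1] at h3
    exact (ENNReal.toReal_ne_zero.2 ⟨hvol0, hvol⟩) (tendsto_nhds_unique h3 tendsto_const_nhds)
  filter_upwards [ae_all_iff.2 h] with ω hω ε hε
  obtain ⟨n, hn⟩ := exists_nat_one_div_lt hε
  obtain ⟨i, hi⟩ := hω n
  exact ⟨i, hi.trans hn⟩

theorem servingDist_nonneg (lam : ℝ) (ω : Ω) : 0 ≤ net.servingDist lam ω :=
  Real.sInf_nonneg (by rintro _ ⟨i, -, rfl⟩; exact norm_nonneg _)

theorem servingDist_le {lam : ℝ} {ω : Ω} {i : ℕ} (hi : net.T i ω ≤ lam) :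
    net.servingDist lam ω ≤ ‖net.X i ω‖ :=
  csInf_le ⟨0, by rintro _ ⟨j, -, rfl⟩; exact norm_nonneg _⟩ ⟨i, hi, rfl⟩

theorem ae_tendsto_servingDist [IsProbabilityMeasure P] :
    ∀ᵐ ω ∂P, Tendsto (fun lam => net.servingDist lam ω) atTop (𝓝 0) := by
  filter_upwards [net.ae_exists_norm_lt] with ω hω
  refine tendsto_order.2 ⟨fun a ha => Eventually.of_forall fun lam =>
    ha.trans_le (net.servingDist_nonneg lam ω), fun a ha => ?_⟩
  obtain ⟨i, hi⟩ := hω a ha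
  filter_upwards [eventually_ge_atTop (net.T i ω)] with lam hlam
  exact (net.servingDist_le hlam).trans_lt hi

/-- The interference power with values in the extended nonnegative real numbers, written with the
power gains that do not depend on the number of antennas. -/
noncomputable def interferenceE (L : ℝ → ℝ) (lam : ℝ) (ω : Ω) : ℝ≥0∞ :=
  ∑' i, (net.interferers lam ω).indicator
    (fun i => ENNReal.ofReal (L ‖net.X i ω‖) * ENNReal.ofReal (net.powerGain i ω)) i

theorem ae_interference_eq {L : ℝ → ℝ} (hL : PhysicallyFeasible L) :
    ∀ᵐ ω ∂P, ∀ lam N, 1 ≤ N →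
      net.interference L N lam ω = (net.interferenceE L lam ω).toReal := by
  filter_upwards [net.ae_gain_eq_powerGain] with ω hω lam N hN
  unfold interference interferenceE
  rw [ENNReal.tsum_toReal_eq fun i => by
    by_cases hi : i ∈ net.interferers lam ω <;> simp [hi, ENNReal.mul_eq_top]]
  refine tsum_congr fun i => ?_
  by_cases hi : i ∈ net.interferers lam ω
  · simp only [Set.indicator_of_mem hi]
    rw [hω i N hN, ENNReal.toReal_mul, ENNReal.toReal_ofReal (hL.nonneg _ (norm_nonneg _)),
      ENNReal.toReal_ofReal (net.powerGain_nonneg i ω)]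
  · simp [Set.indicator_of_notMem hi]

theorem interferenceE_le (L : ℝ → ℝ) (lam : ℝ) (ω : Ω) :
    net.interferenceE L lam ω ≤ markedSum (upToLevel (farGain L (-1)) lam)
      (fun i => net.point i ω) (fun i => ENNReal.ofReal (net.powerGain i ω)) := by
  refine ENNReal.tsum_le_tsum fun i => ?_
  by_cases hi : i ∈ net.interferers lam ω
  · rw [Set.indicator_of_mem hi]
    have h1 : net.point i ω ∈ {q : EuclideanSpace ℝ (Fin 2) × ℝ | q.2 ≤ lam} := hi.1
    have h2 : ‖net.X i ω‖ ∈ Set.Ioi (-1 : ℝ) := by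
      have := norm_nonneg (net.X i ω)
      simp only [Set.mem_Ioi]
      linarith
    unfold upToLevel farGain
    rw [Set.indicator_of_mem h1]
    simp only [point]
    rw [Set.indicator_of_mem h2]
  · rw [Set.indicator_of_notMem hi]
    exact zero_le

theorem le_interferenceE (L : ℝ → ℝ) {lam ε : ℝ} {ω : Ω} (h : net.servingDist lam ω ≤ ε) :
    markedSum (upToLevel (farGain L ε) lam) (fun i => net.point i ω)
      (fun i => ENNReal.ofReal (net.powerGain i ω)) ≤ net.interferenceE L lam ω := by
  refine ENNReal.tsum_le_tsum fun i => ?_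
  unfold upToLevel farGain
  by_cases h1 : net.point i ω ∈ {q : EuclideanSpace ℝ (Fin 2) × ℝ | q.2 ≤ lam}
  · rw [Set.indicator_of_mem h1]
    simp only [point]
    by_cases h2 : ‖net.X i ω‖ ∈ Set.Ioi ε
    · have hi : i ∈ net.interferers lam ω := ⟨h1, h.trans_lt h2⟩
      rw [Set.indicator_of_mem hi, Set.indicator_of_mem h2]
    · simp [Set.indicator_of_notMem h2]
  · simp [Set.indicator_of_notMem h1]

/-- The interference grows like `2πγ` times the density. The serving base station is absent from
the interference; since its distance tends to zero, leaving out the disc of radius `ε` gives a lower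
bound, and `ε` is arbitrary. -/
theorem ae_tendsto_interferenceE_div [IsProbabilityMeasure P] {L : ℝ → ℝ}
    (hL : PhysicallyFeasible L) :
    ∀ᵐ ω ∂P, Tendsto (fun lam => (net.interferenceE L lam ω).toReal / lam) atTop
      (𝓝 (2 * Real.pi * gammaConst L)) := by
  have hlln : ∀ ε, ∀ᵐ ω ∂P, (∀ lam, markedSum (upToLevel (farGain L ε) lam)
        (fun i => net.point i ω) (fun i => ENNReal.ofReal (net.powerGain i ω)) ≠ ∞) ∧
      Tendsto (fun lam => (markedSum (upToLevel (farGain L ε) lam) (fun i => net.point i ω)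
        (fun i => ENNReal.ofReal (net.powerGain i ω))).toReal / lam) atTop
        (𝓝 (2 * Real.pi * farConst L ε)) := fun ε => by
    have := net.ae_tendsto_markedSum_point (hL.measurable_farGain ε)
      (by rw [hL.lintegral_farGain]; exact ENNReal.ofReal_ne_top)
      (hL.lintegral_farGain_sq_ne_top ε)
    rwa [hL.lintegral_farGain, ENNReal.toReal_ofReal
      (mul_nonneg (by positivity) (hL.farConst_nonneg ε))] at this
  filter_upwards [hlln (-1), ae_all_iff.2 fun n : ℕ => hlln (1 / ((n : ℝ) + 1)),
    net.ae_tendsto_servingDist] with ω hup hlow hdist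
  have hfin : ∀ lam, net.interferenceE L lam ω ≠ ∞ := fun lam =>
    ne_top_of_le_ne_top (hup.1 lam) (net.interferenceE_le L lam ω)
  rw [farConst_of_neg L (by norm_num)] at hup
  refine tendsto_order.2 ⟨fun a ha => ?_, fun a ha => ?_⟩
  · obtain ⟨n, hn⟩ := ((hL.tendsto_farConst.const_mul (2 * Real.pi)).eventually
      (lt_mem_nhds ha)).exists
    filter_upwards [(hlow n).2.eventually (lt_mem_nhds hn), eventually_gt_atTop 0,
      hdist.eventually (gt_mem_nhds (Nat.one_div_pos_of_nat (α := ℝ) (n := n)))]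
      with lam h1 h2 h3
    refine h1.trans_le ?_
    gcongr
    · exact hfin lam
    · exact net.le_interferenceE L h3.le
  · filter_upwards [hup.2.eventually (gt_mem_nhds ha), eventually_gt_atTop 0] with lam h1 h2
    refine lt_of_le_of_lt ?_ h1
    gcongr
    · exact hup.1 lam
    · exact net.interferenceE_le L lam ω

theorem norm_hServ_sq (N : ℕ) (ω : Ω) :
    ‖net.hServ N ω‖ ^ 2 = ∑ k ∈ Finset.range N, ‖net.f k ω‖ ^ 2 := by
  rw [EuclideanSpace.norm_sq_eq, Finset.sum_range]
  rfl

theorem lintegral_norm_f_sq (k : ℕ) : ∫⁻ ω, ENNReal.ofReal (‖net.f k ω‖ ^ 2) ∂P = 1 := by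
  rw [← lintegral_norm_sq_complexGaussian]
  exact (net.law_f k).lintegral_comp (f := fun z => ENNReal.ofReal (‖z‖ ^ 2)) (by fun_prop)

/-- **Channel hardening**: the received signal power per antenna tends to `1`. -/
theorem ae_tendsto_norm_hServ_sq_div :
    ∀ᵐ ω ∂P, Tendsto (fun N : ℕ => ‖net.hServ N ω‖ ^ 2 / N) atTop (𝓝 1) := by
  have hm : ∀ k, Measurable fun ω => ‖net.f k ω‖ ^ 2 := fun k => by
    have := net.measurable_f k
    fun_prop
  have hint : Integrable (fun ω => ‖net.f 0 ω‖ ^ 2) P := by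
    refine (lintegral_ofReal_ne_top_iff_integrable (hm 0).aestronglyMeasurable
      (ae_of_all _ fun ω => sq_nonneg _)).1 ?_
    rw [net.lintegral_norm_f_sq]
    exact ENNReal.one_ne_top
  have hval : ∫ ω, ‖net.f 0 ω‖ ^ 2 ∂P = 1 := by
    rw [integral_eq_lintegral_of_nonneg_ae (ae_of_all _ fun ω => sq_nonneg _)
      (hm 0).aestronglyMeasurable, net.lintegral_norm_f_sq, ENNReal.toReal_one]
  have h := strong_law_ae_real (fun k ω => ‖net.f k ω‖ ^ 2) hint
    (fun i j hij => (net.indep_f.indepFun hij).comp (φ := fun z : ℂ => ‖z‖ ^ 2)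
      (ψ := fun z : ℂ => ‖z‖ ^ 2) (by fun_prop) (by fun_prop))
    (fun i => ((net.law_f i).identDistrib (net.law_f 0)).comp (u := fun z : ℂ => ‖z‖ ^ 2)
      (by fun_prop))
  rw [hval] at h
  simpa only [norm_hServ_sq] using h

theorem ae_tendsto_sinr [IsProbabilityMeasure P] {L : ℝ → ℝ} (hL : PhysicallyFeasible L)
    (hL0 : ContinuousWithinAt L (Set.Ici 0) 0) (σ : ℝ) {Nt : ℝ → ℕ}
    (hNt : Tendsto Nt atTop atTop) :
    ∀ᵐ ω ∂P, Tendsto (fun lam : ℝ => lam / (Nt lam : ℝ) * net.sinr L σ (Nt lam) lam ω) atTop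
      (𝓝 (L 0 / (2 * Real.pi * gammaConst L))) := by
  filter_upwards [net.ae_interference_eq hL, net.ae_tendsto_interferenceE_div hL,
    net.ae_tendsto_norm_hServ_sq_div, net.ae_tendsto_servingDist] with ω hI hIlim hS hD
  have hd : Tendsto (fun lam => L (net.servingDist lam ω)) atTop (𝓝 (L 0)) :=
    hL0.tendsto.comp (tendsto_nhdsWithin_iff.2
      ⟨hD, Eventually.of_forall fun lam => net.servingDist_nonneg lam ω⟩)
  have hσ : Tendsto (fun lam : ℝ => σ ^ 2 / lam) atTop (𝓝 0) :=
    tendsto_const_nhds.div_atTop tendsto_id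
  have hne : 2 * Real.pi * gammaConst L + 0 ≠ 0 := by
    have := hL.gammaConst_pos
    positivity
  have hlim := (hd.mul (hS.comp hNt)).div (hIlim.add hσ) hne
  rw [mul_one, add_zero] at hlim
  refine hlim.congr' ?_
  filter_upwards [eventually_gt_atTop (0 : ℝ), hNt.eventually_ge_atTop 1] with lam hlam hN
  simp only [Function.comp_apply, Pi.div_apply]
  unfold sinr
  rw [gain_mrt_self, hI lam (Nt lam) hN, ← add_div]
  have hN' : (Nt lam : ℝ) ≠ 0 := by positivity
  field_simp

end Network

/-! ### Scaling regimes -/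

section Regimes

variable {s q : ℝ → ℝ} {c : ℝ}

theorem isEquivalent_of_tendsto_mul (hc : c ≠ 0) (hq : ∀ᶠ x in atTop, q x ≠ 0)
    (h : Tendsto (fun x => q x * s x) atTop (𝓝 c)) : s ~[atTop] fun x => c * (q x)⁻¹ := by
  rw [isEquivalent_iff_tendsto_one (by
    filter_upwards [hq] with x hx
    exact mul_ne_zero hc (inv_ne_zero hx))]
  have h1 := h.div_const c
  rw [div_self hc] at h1
  refine h1.congr' ?_
  filter_upwards [hq] with x hx
  simp only [Pi.div_apply]
  field_simp

theorem tendsto_of_tendsto_mul (hq : ∀ᶠ x in atTop, q x ≠ 0)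
    {l : Filter ℝ} (hl : Tendsto (fun x => (q x * s x) * (q x)⁻¹) atTop l) : Tendsto s atTop l := by
  refine hl.congr' ?_
  filter_upwards [hq] with x hx
  field_simp

end Regimes

/-! ### Negative moments of sums of exponential gains -/

theorem inv_sq_le_lintegral_exp {x : ℝ} (hx : 0 ≤ x) :
    (ENNReal.ofReal x ^ 2)⁻¹ ≤
      ∫⁻ s in Set.Ioi (0 : ℝ), ENNReal.ofReal s * ENNReal.ofReal (Real.exp (-(s * x))) := by
  rcases hx.eq_or_lt with rfl | hx
  · have h : ∫⁻ _ in Set.Ioi (1 : ℝ), (1 : ℝ≥0∞) ≤ ∫⁻ s in Set.Ioi (0 : ℝ),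
        ENNReal.ofReal s * ENNReal.ofReal (Real.exp (-(s * 0))) := by
      refine (setLIntegral_mono' measurableSet_Ioi fun s hs => ?_).trans
        (lintegral_mono_set (Set.Ioi_subset_Ioi zero_le_one))
      simp only [mul_zero, neg_zero, Real.exp_zero, ENNReal.ofReal_one, mul_one]
      exact ENNReal.one_le_ofReal.2 (le_of_lt hs)
    rw [setLIntegral_const, Real.volume_Ioi, one_mul, top_le_iff] at h
    rw [h]
    exact le_top
  · have h1 := Real.integral_rpow_mul_exp_neg_mul_Ioi (a := 2) two_pos hx
    have h2 : ∀ t : ℝ, t ^ ((2 : ℝ) - 1) * Real.exp (-(x * t)) = t * Real.exp (-(t * x)) := by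
      intro t
      rw [show (2 : ℝ) - 1 = 1 by norm_num, Real.rpow_one, mul_comm x t]
    simp_rw [h2] at h1
    rw [show (2 : ℝ) = ((2 : ℕ) : ℝ) by norm_num, Real.rpow_natCast, Nat.cast_ofNat,
      Real.Gamma_two, mul_one] at h1
    have hne : ∫ t in Set.Ioi (0 : ℝ), t * Real.exp (-(t * x)) ≠ 0 := by
      rw [h1]; positivity
    have h3 := ofReal_integral_eq_lintegral_ofReal (not_imp_comm.1 integral_undef hne)
      ((ae_restrict_iff' measurableSet_Ioi).2 (ae_of_all _ fun t ht =>
        mul_nonneg (le_of_lt ht) (Real.exp_pos _).le))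
    have h4 : ∫⁻ s in Set.Ioi (0 : ℝ), ENNReal.ofReal s * ENNReal.ofReal (Real.exp (-(s * x))) =
        ∫⁻ s in Set.Ioi (0 : ℝ), ENNReal.ofReal (s * Real.exp (-(s * x))) :=
      setLIntegral_congr_fun measurableSet_Ioi fun s hs =>
        (ENNReal.ofReal_mul (le_of_lt hs)).symm
    rw [h4, ← h3, h1, ← ENNReal.ofReal_pow hx.le, ← ENNReal.ofReal_inv_of_pos (by positivity)]
    refine ENNReal.ofReal_le_ofReal (le_of_eq ?_)
    rw [one_div, inv_pow]

theorem lintegral_mul_inv_one_add_pow (k : ℕ) :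
    ∫⁻ s in Set.Ioi (0 : ℝ), ENNReal.ofReal (s * (1 / (1 + s)) ^ (k + 3)) =
      ENNReal.ofReal (1 / ((k + 1) * (k + 2))) := by
  set F : ℝ → ℝ := fun s =>
    -((k + 1 : ℝ)⁻¹ * ((1 + s) ^ (k + 1))⁻¹) + (k + 2 : ℝ)⁻¹ * ((1 + s) ^ (k + 2))⁻¹ with hF
  have hderiv : ∀ s ∈ Set.Ici (0 : ℝ), HasDerivAt F (s * (1 / (1 + s)) ^ (k + 3)) s := by
    intro s hs
    have hs' : (0 : ℝ) ≤ s := hs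
    have h1 : (1 + s) ≠ 0 := by positivity
    have hb : HasDerivAt (fun s : ℝ => 1 + s) 1 s := (hasDerivAt_id s).const_add 1
    have hp : ∀ n : ℕ, HasDerivAt (fun s : ℝ => ((1 + s) ^ (n + 1))⁻¹)
        (-((n + 1 : ℕ) * (1 + s) ^ n) / ((1 + s) ^ (n + 1)) ^ 2) s := fun n => by
      have := (hb.fun_pow (n + 1)).fun_inv (pow_ne_zero _ h1)
      simpa using this
    have := ((hp k).const_mul (k + 1 : ℝ)⁻¹).fun_neg.fun_add ((hp (k + 1)).const_mul (k + 2 : ℝ)⁻¹)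
    refine this.congr_deriv ?_
    push_cast
    have e : (k : ℝ) + 1 + 1 = k + 2 := by ring
    rw [e, one_div, inv_pow]
    field_simp
    ring
  have hpos : ∀ s ∈ Set.Ioi (0 : ℝ), 0 ≤ s * (1 / (1 + s)) ^ (k + 3) := fun s hs => by
    have : (0 : ℝ) < s := hs
    positivity
  have hlim : Tendsto F atTop (𝓝 0) := by
    have h0 : ∀ n : ℕ, Tendsto (fun s : ℝ => ((1 + s) ^ (n + 1))⁻¹) atTop (𝓝 0) := fun n =>
      ((tendsto_pow_atTop n.succ_ne_zero).comp
        (tendsto_atTop_add_const_left _ (1 : ℝ) tendsto_id)).inv_tendsto_atTop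
    simpa using (((h0 k).const_mul (k + 1 : ℝ)⁻¹).neg).add ((h0 (k + 1)).const_mul (k + 2 : ℝ)⁻¹)
  have hint := integrableOn_Ioi_deriv_of_nonneg' hderiv hpos hlim
  rw [← ofReal_integral_eq_lintegral_ofReal hint
    ((ae_restrict_iff' measurableSet_Ioi).2 (ae_of_all _ hpos)),
    integral_Ioi_of_hasDerivAt_of_nonneg' hderiv hpos hlim]
  congr 1
  simp only [hF, add_zero, one_pow, inv_one, mul_one]
  field_simp
  ring

section Gains

variable {Ω : Type*} [MeasurableSpace Ω] {P : Measure Ω}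

/-- For `n ≥ 3` independent exponential variables with mean `1`, the inverse square of the sum has
mean `1 / ((n - 1) (n - 2))`. The weaker bound stated here matches the negative factorial moment of
the Poisson distribution. -/
theorem lintegral_inv_sum_sq_le [IsProbabilityMeasure P] {g : ℕ → Ω → ℝ}
    (hg : ∀ i, Measurable (g i)) (hg0 : ∀ i ω, 0 ≤ g i ω) (hgi : iIndepFun g P)
    (hlap : ∀ i s, 0 ≤ s → ∫⁻ ω, ENNReal.ofReal (Real.exp (-(s * g i ω))) ∂P =
      ENNReal.ofReal (1 / (1 + s))) (J : Finset ℕ) (hJ : 3 ≤ J.card) :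
    ∫⁻ ω, ((∑ i ∈ J, ENNReal.ofReal (g i ω)) ^ 2)⁻¹ ∂P ≤
      10 * (((J.card : ℝ≥0∞) + 1) * (J.card + 2))⁻¹ := by
  obtain ⟨k, hk⟩ := Nat.exists_eq_add_of_le' hJ
  have hsum : ∀ ω, ∑ i ∈ J, ENNReal.ofReal (g i ω) = ENNReal.ofReal (∑ i ∈ J, g i ω) := fun ω =>
    (ENNReal.ofReal_sum_of_nonneg fun i _ => hg0 i ω).symm
  have hexp : ∀ s, 0 ≤ s → ∫⁻ ω, ENNReal.ofReal (Real.exp (-(s * ∑ i ∈ J, g i ω))) ∂P =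
      ENNReal.ofReal ((1 / (1 + s)) ^ (k + 3)) := by
    intro s hs
    have h1 : ∀ ω, ENNReal.ofReal (Real.exp (-(s * ∑ i ∈ J, g i ω))) =
        ∏ i ∈ J, ENNReal.ofReal (Real.exp (-(s * g i ω))) := fun ω => by
      rw [← ENNReal.ofReal_prod_of_nonneg fun i _ => (Real.exp_pos _).le, ← Real.exp_sum,
        Finset.mul_sum, Finset.sum_neg_distrib]
    simp_rw [h1]
    rw [lintegral_prod_eq_prod_lintegral_of_indepFun J
      (fun i ω => ENNReal.ofReal (Real.exp (-(s * g i ω))))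
      (hgi.comp (fun _ x => ENNReal.ofReal (Real.exp (-(s * x)))) fun _ => by fun_prop)
      fun i => by have := hg i; fun_prop]
    simp_rw [hlap _ s hs]
    rw [Finset.prod_const, hk, ENNReal.ofReal_pow (by positivity)]
  calc _ ≤ ∫⁻ ω, (∫⁻ s in Set.Ioi (0 : ℝ), ENNReal.ofReal s *
          ENNReal.ofReal (Real.exp (-(s * ∑ i ∈ J, g i ω)))) ∂P := by
        refine lintegral_mono fun ω => ?_
        rw [hsum]
        exact inv_sq_le_lintegral_exp (Finset.sum_nonneg fun i _ => hg0 i ω)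
    _ = ∫⁻ s in Set.Ioi (0 : ℝ), ∫⁻ ω, ENNReal.ofReal s *
          ENNReal.ofReal (Real.exp (-(s * ∑ i ∈ J, g i ω))) ∂P := by
        refine lintegral_lintegral_swap ?_
        have : Measurable fun p : Ω × ℝ => ∑ i ∈ J, g i p.1 :=
          Finset.measurable_fun_sum _ fun i _ => (hg i).comp measurable_fst
        exact Measurable.aemeasurable (by unfold Function.uncurry; fun_prop)
    _ = ∫⁻ s in Set.Ioi (0 : ℝ), ENNReal.ofReal (s * (1 / (1 + s)) ^ (k + 3)) := by
        refine setLIntegral_congr_fun measurableSet_Ioi fun s hs => ?_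
        have hs' : (0 : ℝ) ≤ s := le_of_lt hs
        have hm : Measurable fun ω => ∑ i ∈ J, g i ω :=
          Finset.measurable_fun_sum _ fun i _ => hg i
        rw [lintegral_const_mul _ (by fun_prop), hexp s hs', ENNReal.ofReal_mul hs']
    _ = ENNReal.ofReal (1 / ((k + 1) * (k + 2))) := lintegral_mul_inv_one_add_pow k
    _ ≤ ENNReal.ofReal (10 * (((k + 3 : ℝ) + 1) * (k + 3 + 2))⁻¹) := by
        refine ENNReal.ofReal_le_ofReal ?_
        rw [← div_eq_mul_inv, div_le_div_iff₀ (by positivity) (by positivity)]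
        nlinarith [(Nat.cast_nonneg k : (0 : ℝ) ≤ k)]
    _ = _ := by
        rw [ENNReal.ofReal_mul (by norm_num), ENNReal.ofReal_inv_of_pos (by positivity), hk]
        congr 2
        · norm_num
        · rw [← ENNReal.ofReal_natCast (k + 3), ← ENNReal.ofReal_one, ← ENNReal.ofReal_ofNat 2,
            ← ENNReal.ofReal_add (by positivity) (by positivity),
            ← ENNReal.ofReal_add (by positivity) (by positivity),
            ← ENNReal.ofReal_mul (by positivity)]
          push_cast
          rfl

theorem lintegral_inv_markedSum_sq_le [IsProbabilityMeasure P] {E : Type*} {g : ℕ → Ω → ℝ}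
    (hg : ∀ i, Measurable (g i)) (hg0 : ∀ i ω, 0 ≤ g i ω) (hgi : iIndepFun g P)
    (hlap : ∀ i s, 0 ≤ s → ∫⁻ ω, ENNReal.ofReal (Real.exp (-(s * g i ω))) ∂P =
      ENNReal.ofReal (1 / (1 + s))) {B : Set E} {z : ℕ → E} (h3 : 3 ≤ pointCount B z)
    (hfin : pointCount B z ≠ ∞) :
    ∫⁻ ω, (markedSum (B.indicator 1) z (fun i => ENNReal.ofReal (g i ω)) ^ 2)⁻¹ ∂P ≤
      10 * ((pointCount B z + 1) * (pointCount B z + 2))⁻¹ := by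
  rw [pointCount_eq_encard] at hfin h3
  have hf : {i | z i ∈ B}.Finite := by
    rw [← Set.encard_lt_top_iff]
    exact lt_top_iff_ne_top.2 fun h => hfin (by rw [h]; rfl)
  set J := hf.toFinset with hJ
  have hcard : (({i | z i ∈ B}.encard : ℕ∞) : ℝ≥0∞) = (J.card : ℝ≥0∞) := by
    rw [hf.encard_eq_coe_toFinset_card]
    rfl
  rw [pointCount_eq_encard, hcard]
  rw [hcard] at h3
  refine le_trans (le_of_eq ?_) (lintegral_inv_sum_sq_le hg hg0 hgi hlap J (by exact_mod_cast h3))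
  refine lintegral_congr fun ω => ?_
  congr 2
  unfold markedSum
  rw [tsum_eq_sum (s := J)]
  · refine Finset.sum_congr rfl fun i hi => ?_
    have : z i ∈ B := by simpa [hJ] using hi
    simp [this]
  · intro i hi
    have : z i ∉ B := by simpa [hJ] using hi
    simp [this]

theorem lintegral_comp_of_indepFun [IsProbabilityMeasure P] {α β : Type*} [MeasurableSpace α]
    [MeasurableSpace β] {Z : Ω → α} {Y : Ω → β} (hZ : Measurable Z) (hY : Measurable Y)
    (h : IndepFun Z Y P) {F : α → β → ℝ≥0∞} (hF : Measurable fun p : α × β => F p.1 p.2) :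
    ∫⁻ ω, F (Z ω) (Y ω) ∂P = ∫⁻ ω, ∫⁻ ω', F (Z ω) (Y ω') ∂P ∂P := by
  have h1 := (indepFun_iff_map_prod_eq_prod_map_map hZ.aemeasurable hY.aemeasurable).1 h
  have : IsProbabilityMeasure (P.map Y) := Measure.isProbabilityMeasure_map hY.aemeasurable
  calc _ = ∫⁻ p, F p.1 p.2 ∂(P.map fun ω => (Z ω, Y ω)) :=
        (lintegral_map hF (hZ.prodMk hY)).symm
    _ = ∫⁻ z, ∫⁻ y, F z y ∂(P.map Y) ∂(P.map Z) := by
        rw [h1, lintegral_prod _ hF.aemeasurable]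
    _ = ∫⁻ ω, ∫⁻ y, F (Z ω) y ∂(P.map Y) ∂P := lintegral_map hF.lintegral_prod_right' hZ
    _ = _ := by
        refine lintegral_congr fun ω => ?_
        exact lintegral_map (hF.comp (measurable_const.prodMk measurable_id)) hY

/-- Conditionally on the points `Z`, the marks of the points in `B` are independent exponential
variables, and they are independent of `A`. -/
theorem lintegral_indicator_mul_inv_markedSum_sq_le [IsProbabilityMeasure P] {E α : Type*}
    [MeasurableSpace E] [MeasurableSpace α] {Z : ℕ → Ω → E} {A : Ω → α} {g : ℕ → Ω → ℝ}
    (hZ : Measurable fun ω i => Z i ω) (hA : Measurable A)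
    (hg : ∀ i, Measurable (g i)) (hg0 : ∀ i ω, 0 ≤ g i ω) (hgi : iIndepFun g P)
    (hlap : ∀ i s, 0 ≤ s → ∫⁻ ω, ENNReal.ofReal (Real.exp (-(s * g i ω))) ∂P =
      ENNReal.ofReal (1 / (1 + s)))
    (hind : IndepFun (fun ω i => Z i ω) (fun ω => (A ω, fun i => g i ω)) P)
    (hAg : IndepFun A (fun ω i => g i ω) P) {B : Set E} (hB : MeasurableSet B)
    {D : Set (ℕ → E)} (hD : MeasurableSet D)
    (hDB : ∀ z ∈ D, 3 ≤ pointCount B z ∧ pointCount B z ≠ ∞)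
    {φ : α → ℝ≥0∞} (hφ : Measurable φ) :
    ∫⁻ ω, D.indicator 1 (fun i => Z i ω) * (φ (A ω) * (markedSum (B.indicator 1)
        (fun i => Z i ω) (fun i => ENNReal.ofReal (g i ω)) ^ 2)⁻¹) ∂P ≤
      10 * (∫⁻ ω, φ (A ω) ∂P) * ∫⁻ ω, D.indicator 1 (fun i => Z i ω) *
          ((pointCount B (fun i => Z i ω) + 1) * (pointCount B (fun i => Z i ω) + 2))⁻¹ ∂P := by
  have hDm : Measurable (D.indicator (1 : (ℕ → E) → ℝ≥0∞)) := measurable_const.indicator hD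
  have hγ : Measurable fun ω => fun i => g i ω := measurable_pi_lambda _ hg
  have hms : Measurable fun p : (ℕ → E) × (ℕ → ℝ) =>
      (markedSum (B.indicator 1) p.1 (fun i => ENNReal.ofReal (p.2 i)) ^ 2)⁻¹ :=
    (((measurable_markedSum (measurable_const.indicator hB)).comp (measurable_fst.prodMk
      (measurable_pi_lambda _ fun i =>
        ((measurable_pi_apply i).comp measurable_snd).ennreal_ofReal))).pow_const 2).inv
  have hK : ∀ K : (ℕ → E) → (ℕ → ℝ) → ℝ≥0∞, Measurable (fun p : (ℕ → E) × (ℕ → ℝ) => K p.1 p.2) →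
      ∫⁻ ω, D.indicator 1 (fun i => Z i ω) * (φ (A ω) * K (fun i => Z i ω) fun i => g i ω) ∂P =
      ∫⁻ ω, D.indicator 1 (fun i => Z i ω) * ((∫⁻ ω', φ (A ω') ∂P) *
        ∫⁻ ω', K (fun i => Z i ω) (fun i => g i ω') ∂P) ∂P := by
    intro K hKm
    have hF : Measurable fun p : (ℕ → E) × (α × (ℕ → ℝ)) =>
        D.indicator 1 p.1 * (φ p.2.1 * K p.1 p.2.2) :=
      (hDm.comp measurable_fst).mul ((hφ.comp (measurable_fst.comp measurable_snd)).mul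
        (hKm.comp (measurable_fst.prodMk (measurable_snd.comp measurable_snd))))
    rw [lintegral_comp_of_indepFun hZ (hA.prodMk hγ) hind
      (F := fun z y => D.indicator 1 z * (φ y.1 * K z y.2)) hF]
    refine lintegral_congr fun ω => ?_
    have hm2 : Measurable fun γ : ℕ → ℝ => K (fun i => Z i ω) γ :=
      hKm.comp (measurable_const.prodMk measurable_id)
    have h2 := lintegral_mul_eq_lintegral_mul_lintegral_of_indepFun
      (hφ.comp hA) (hm2.comp hγ) (hAg.comp hφ hm2)
    have h3 : Measurable fun ω' => φ (A ω') * K (fun i => Z i ω) fun i => g i ω' :=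
      (hφ.comp hA).mul (hm2.comp hγ)
    rw [lintegral_const_mul _ h3]
    congr 1
  have hcm : Measurable fun ω => pointCount B fun i => Z i ω := (measurable_pointCount hB).comp hZ
  have hDp : Measurable fun ω => D.indicator (1 : (ℕ → E) → ℝ≥0∞) fun i => Z i ω := hDm.comp hZ
  have hR : Measurable fun ω => D.indicator (1 : (ℕ → E) → ℝ≥0∞) (fun i => Z i ω) *
      ((pointCount B (fun i => Z i ω) + 1) * (pointCount B (fun i => Z i ω) + 2))⁻¹ :=
    hDp.mul ((hcm.add_const 1).mul (hcm.add_const 2)).inv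
  rw [hK (fun z γ => (markedSum (B.indicator 1) z (fun i => ENNReal.ofReal (γ i)) ^ 2)⁻¹) hms,
    ← lintegral_const_mul _ hR]
  refine lintegral_mono fun ω => ?_
  by_cases hz : (fun i => Z i ω) ∈ D
  · simp only [Set.indicator_of_mem hz, Pi.one_apply, one_mul]
    rw [mul_comm (10 : ℝ≥0∞), mul_assoc]
    exact mul_le_mul_right (lintegral_inv_markedSum_sq_le hg hg0 hgi hlap (hDB _ hz).1
      (hDB _ hz).2) _
  · simp [Set.indicator_of_notMem hz]

end Gains

/-! ### Lower bounds for the path loss -/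

/-- The differential inequality in the tail condition says that `L̃(r) exp(r² / (2ζ))` is
non-decreasing, so the path loss has a Gaussian minorant. -/
theorem TailCondition.exists_gaussian_le {L : ℝ → ℝ} (h : TailCondition L) :
    ∃ ρ a c : ℝ, 0 ≤ ρ ∧ 0 ≤ a ∧ 0 < c ∧ ∀ r, ρ ≤ r → c * Real.exp (-(a * r ^ 2)) ≤ L r := by
  obtain ⟨ρ, hρ, ζ, hζ, Lt, hd, -, hpos, hle, hζd, -⟩ := h
  refine ⟨ρ, 1 / (2 * ζ), Lt ρ * Real.exp (1 / (2 * ζ) * ρ ^ 2), hρ, by positivity,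
    mul_pos (hpos ρ Set.self_mem_Ici) (Real.exp_pos _), fun r hr => ?_⟩
  have hmono : MonotoneOn (fun r => Lt r * Real.exp (1 / (2 * ζ) * r ^ 2)) (Set.Ici ρ) := by
    have hE : ∀ x : ℝ, HasDerivAt (fun r => Real.exp (1 / (2 * ζ) * r ^ 2))
        (Real.exp (1 / (2 * ζ) * x ^ 2) * (x / ζ)) x := fun x => by
      have := (((hasDerivAt_id x).fun_pow 2).const_mul (1 / (2 * ζ))).exp
      refine this.congr_deriv ?_
      simp only [id_eq, Nat.cast_ofNat, Nat.add_one_sub_one, pow_one, mul_one]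
      field_simp
    refine monotoneOn_of_deriv_nonneg (convex_Ici ρ)
      (hd.continuousOn.mul (by fun_prop)) ?_ ?_
    · rw [interior_Ici]
      exact (hd.mono Set.Ioi_subset_Ici_self).mul (by fun_prop)
    · rw [interior_Ici]
      intro x hx
      have hxI : x ∈ Set.Ici ρ := Set.mem_Ici.2 (le_of_lt (Set.mem_Ioi.1 hx))
      have hda : HasDerivAt Lt (derivWithin Lt (Set.Ici ρ) x) x :=
        (hd x hxI).hasDerivWithinAt.hasDerivAt (Ici_mem_nhds hx)
      rw [(hda.fun_mul (hE x)).deriv]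
      have h1 := hζd x hxI
      have h2 : derivWithin Lt (Set.Ici ρ) x * Real.exp (1 / (2 * ζ) * x ^ 2) +
          Lt x * (Real.exp (1 / (2 * ζ) * x ^ 2) * (x / ζ)) =
          Real.exp (1 / (2 * ζ) * x ^ 2) / ζ *
            (x * Lt x - ζ * (-derivWithin Lt (Set.Ici ρ) x)) := by
        field_simp
        ring
      rw [h2]
      exact mul_nonneg (by positivity) (by linarith)
  have h1 := hmono Set.self_mem_Ici (show r ∈ Set.Ici ρ from hr) hr
  simp only at h1
  calc _ ≤ Lt r * Real.exp (1 / (2 * ζ) * r ^ 2) * Real.exp (-(1 / (2 * ζ) * r ^ 2)) := by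
        gcongr
    _ = Lt r := by rw [mul_assoc, ← Real.exp_add, add_neg_cancel, Real.exp_zero, mul_one]
    _ ≤ L r := hle r hr

theorem PhysicallyFeasible.exists_half_le {L : ℝ → ℝ} (hL : PhysicallyFeasible L)
    (hL0 : ContinuousWithinAt L (Set.Ici 0) 0) :
    ∃ R : ℝ, 0 < R ∧ ∀ r, 0 ≤ r → r < 2 * R → L 0 / 2 ≤ L r := by
  have h : ∀ᶠ r in 𝓝[≥] (0 : ℝ), L 0 / 2 < L r :=
    hL0.tendsto.eventually (lt_mem_nhds (by linarith [hL.zero_pos]))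
  obtain ⟨b, hb, hsub⟩ := mem_nhdsGE_iff_exists_Ico_subset.1 h
  have hb' : (0 : ℝ) < b := hb
  exact ⟨b / 2, by positivity, fun r h0 h1 => (hsub ⟨h0, by linarith⟩ : L 0 / 2 < L r).le⟩

/-! ### Second moment of the normalized SINR -/

theorem IsPoissonProcess.measure_pointCount_mem {Ω E : Type*} [MeasurableSpace Ω]
    [MeasurableSpace E] {Z : ℕ → Ω → E} {μ : Measure E} {P : Measure Ω}
    (hZ : IsPoissonProcess Z μ P) {B : Set E} (hB : MeasurableSet B) (hμB : μ B ≠ ∞)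
    {S : Set ℝ≥0∞} (hS : MeasurableSet S) :
    P {ω | pointCount B (fun i => Z i ω) ∈ S} =
      poissonMeasure (μ B).toNNReal {n | (n : ℝ≥0∞) ∈ S} := by
  have hm : MeasurableSet {ω | pointCount B (fun i => Z i ω) ∈ S} :=
    ((measurable_pointCount hB).comp hZ.measurable_apply) hS
  rw [← lintegral_indicator_one hm, ← lintegral_indicator_one (MeasurableSet.of_discrete)]
  exact hZ.lintegral_comp_pointCount hB hμB (F := S.indicator 1)
    ((measurable_const (a := (1 : ℝ≥0∞))).indicator hS)

/-- The intensity measure on the plane and the appearance levels. -/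
noncomputable abbrev levelIntensity : Measure (EuclideanSpace ℝ (Fin 2) × ℝ) :=
  (volume : Measure (EuclideanSpace ℝ (Fin 2))).prod (volume.restrict (Set.Ici (0 : ℝ)))

/-- Base stations with level at most `lam` at distance less than `R` from the origin. -/
def discUpTo (R lam : ℝ) : Set (EuclideanSpace ℝ (Fin 2) × ℝ) :=
  Metric.ball 0 R ×ˢ Set.Iic lam

/-- Base stations with level at most `lam` at distance in `[R, 2R)` from the origin. -/
def annulusUpTo (R lam : ℝ) : Set (EuclideanSpace ℝ (Fin 2) × ℝ) :=
  (Metric.ball 0 (2 * R) \ Metric.ball 0 R) ×ˢ Set.Iic lam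

theorem measurableSet_discUpTo (R lam : ℝ) : MeasurableSet (discUpTo R lam) :=
  measurableSet_ball.prod measurableSet_Iic

theorem measurableSet_annulusUpTo (R lam : ℝ) : MeasurableSet (annulusUpTo R lam) :=
  (measurableSet_ball.diff measurableSet_ball).prod measurableSet_Iic

theorem levelIntensity_prod_Iic (S : Set (EuclideanSpace ℝ (Fin 2))) (lam : ℝ) :
    levelIntensity (S ×ˢ Set.Iic lam) = volume S * ENNReal.ofReal lam := by
  have : Set.Iic lam ∩ Set.Ici 0 = Set.Icc 0 lam := by rw [Set.inter_comm]; rfl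
  rw [levelIntensity, Measure.prod_prod, Measure.restrict_apply measurableSet_Iic, this,
    Real.volume_Icc, sub_zero]

theorem levelIntensity_discUpTo {R : ℝ} (hR : 0 ≤ R) (lam : ℝ) :
    levelIntensity (discUpTo R lam) = ENNReal.ofReal (Real.pi * R ^ 2 * lam) := by
  rw [discUpTo, levelIntensity_prod_Iic, EuclideanSpace.volume_ball_fin_two,
    ← ENNReal.ofReal_pow hR, ← ENNReal.ofReal_mul (by positivity),
    ← ENNReal.ofReal_mul (by positivity)]
  congr 1
  ring

theorem levelIntensity_annulusUpTo {R lam : ℝ} (hR : 0 ≤ R) (hlam : 0 ≤ lam) :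
    levelIntensity (annulusUpTo R lam) = ENNReal.ofReal (3 * Real.pi * R ^ 2 * lam) := by
  rw [annulusUpTo, levelIntensity_prod_Iic, measure_sdiff (Metric.ball_subset_ball (by linarith))
    measurableSet_ball.nullMeasurableSet measure_ball_lt_top.ne,
    EuclideanSpace.volume_ball_fin_two, EuclideanSpace.volume_ball_fin_two,
    ← ENNReal.ofReal_pow hR, ← ENNReal.ofReal_pow (by positivity),
    ← ENNReal.ofReal_mul (by positivity), ← ENNReal.ofReal_mul (by positivity),
    ← ENNReal.ofReal_sub _ (by positivity), ← ENNReal.ofReal_mul' hlam]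
  congr 1
  ring

/-- Configurations with a base station at distance less than `R`, and at least three (but finitely
many) base stations at distance in `[R, 2R)`. All of the latter are then interferers, and three
exponential gains are enough for the inverse square of their sum to have a finite mean. -/
def threeInterferers (R lam : ℝ) : Set (ℕ → EuclideanSpace ℝ (Fin 2) × ℝ) :=
  {z | 1 ≤ pointCount (discUpTo R lam) z ∧ 3 ≤ pointCount (annulusUpTo R lam) z ∧
    pointCount (annulusUpTo R lam) z ≠ ∞}

theorem measurableSet_threeInterferers (R lam : ℝ) : MeasurableSet (threeInterferers R lam) :=
  (measurableSet_le measurable_const (measurable_pointCount (measurableSet_discUpTo R lam))).inter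
    ((measurableSet_le measurable_const
      (measurable_pointCount (measurableSet_annulusUpTo R lam))).inter
    ((measurable_pointCount (measurableSet_annulusUpTo R lam))
      (measurableSet_singleton ∞).compl))

theorem exp_neg_le_two_div_sq {x : ℝ} (hx : 0 < x) : Real.exp (-x) ≤ 2 / x ^ 2 := by
  have h := Real.quadratic_le_exp_of_nonneg hx.le
  rw [Real.exp_neg, inv_eq_one_div, div_le_div_iff₀ (Real.exp_pos x) (by positivity)]
  nlinarith

namespace Network

variable {Ω : Type*} [MeasurableSpace Ω] {P : Measure Ω} (net : Network P)

theorem measurable_point_apply : Measurable fun ω => fun i => net.point i ω :=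
  net.isPoissonProcess_point.measurable_apply

theorem measurable_f_apply : Measurable fun ω => fun k => net.f k ω :=
  measurable_pi_lambda _ net.measurable_f

theorem measure_compl_threeInterferers_le {R lam : ℝ} (hR : 0 ≤ R) (hlam : 0 ≤ lam) :
    P {ω | (fun i => net.point i ω) ∉ threeInterferers R lam} ≤
      ENNReal.ofReal (5 * Real.exp (-(lam * R ^ 2))) := by
  have hD := levelIntensity_discUpTo hR lam
  have hA := levelIntensity_annulusUpTo hR hlam
  have hDt : levelIntensity (discUpTo R lam) ≠ ∞ := by rw [hD]; exact ENNReal.ofReal_ne_top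
  have hAt : levelIntensity (annulusUpTo R lam) ≠ ∞ := by rw [hA]; exact ENNReal.ofReal_ne_top
  have h1 := net.isPoissonProcess_point.measure_pointCount_mem (measurableSet_discUpTo R lam) hDt
    (S := Set.Iio 1) measurableSet_Iio
  have h2 := net.isPoissonProcess_point.measure_pointCount_mem (measurableSet_annulusUpTo R lam) hAt
    (S := Set.Iio 3) measurableSet_Iio
  have h3 := net.isPoissonProcess_point.measure_pointCount_mem (measurableSet_annulusUpTo R lam) hAt
    (S := {∞}) (measurableSet_singleton _)
  have s1 : {n : ℕ | (n : ℝ≥0∞) ∈ Set.Iio (1 : ℝ≥0∞)} = {0} := by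
    ext n
    simp
  have s2 : {n : ℕ | (n : ℝ≥0∞) ∈ Set.Iio (3 : ℝ≥0∞)} = {n | n ≤ 2} := by
    ext n
    have : ((n : ℝ≥0∞) < 3) ↔ n < 3 := by exact_mod_cast Nat.cast_lt (α := ℝ≥0∞)
    simp only [Set.mem_Iio, Set.mem_ofPred_eq, this]
    omega
  have s3 : {n : ℕ | (n : ℝ≥0∞) ∈ ({∞} : Set ℝ≥0∞)} = ∅ := by
    ext n
    simp
  rw [s1] at h1
  rw [s2] at h2
  rw [s3, measure_empty] at h3
  have hsub : {ω | (fun i => net.point i ω) ∉ threeInterferers R lam} ⊆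
      ({ω | pointCount (discUpTo R lam) (fun i => net.point i ω) ∈ Set.Iio 1} ∪
      {ω | pointCount (annulusUpTo R lam) (fun i => net.point i ω) ∈ Set.Iio 3}) ∪
      {ω | pointCount (annulusUpTo R lam) (fun i => net.point i ω) ∈ ({∞} : Set ℝ≥0∞)} := by
    intro ω hω
    by_contra hcon
    simp only [Set.mem_union, Set.mem_ofPred_eq, Set.mem_Iio, Set.mem_singleton_iff, not_or,
      not_lt] at hcon
    exact hω ⟨hcon.1.1, hcon.1.2, hcon.2⟩
  have hpi := Real.pi_gt_three
  have hq : 0 ≤ R ^ 2 * lam := by positivity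
  refine (measure_mono hsub).trans ((measure_union_le _ _).trans ?_)
  rw [h3, add_zero]
  refine (measure_union_le _ _).trans ?_
  rw [h1, h2]
  refine (add_le_add (poissonMeasure_zero_le _) (poissonMeasure_le_two _)).trans ?_
  rw [← ENNReal.ofReal_add (by positivity) (by positivity)]
  refine ENNReal.ofReal_le_ofReal ?_
  have e1 : (((levelIntensity (discUpTo R lam)).toNNReal : ℝ≥0) : ℝ) = Real.pi * R ^ 2 * lam := by
    rw [ENNReal.coe_toNNReal_eq_toReal, hD, ENNReal.toReal_ofReal (by positivity)]
  have e2 : (((levelIntensity (annulusUpTo R lam)).toNNReal : ℝ≥0) : ℝ) =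
      3 * Real.pi * R ^ 2 * lam := by
    rw [ENNReal.coe_toNNReal_eq_toReal, hA, ENNReal.toReal_ofReal (by positivity)]
  rw [e1, e2]
  have i1 : Real.exp (-(Real.pi * R ^ 2 * lam / 2)) ≤ Real.exp (-(lam * R ^ 2)) :=
    Real.exp_le_exp.2 (by nlinarith)
  have i2 : Real.exp (-(3 * Real.pi * R ^ 2 * lam / 2)) ≤ Real.exp (-(lam * R ^ 2)) :=
    Real.exp_le_exp.2 (by nlinarith)
  linarith

/-- The total power gain of the base stations in the annulus `[R, 2R)`. -/
noncomputable def annulusGain (R lam : ℝ) (ω : Ω) : ℝ≥0∞ :=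
  markedSum ((annulusUpTo R lam).indicator 1) (fun i => net.point i ω)
    (fun i => ENNReal.ofReal (net.powerGain i ω))

theorem measurable_annulusGain (R lam : ℝ) : Measurable (net.annulusGain R lam) :=
  measurable_markedSum_comp net.measurable_point_apply
    (fun i => (net.measurable_powerGain i).ennreal_ofReal)
    (measurable_one.indicator (measurableSet_annulusUpTo R lam))

theorem mul_annulusGain_le_interferenceE {L : ℝ → ℝ} {R lam ℓ : ℝ}
    (hℓ : ∀ r, R ≤ r → r < 2 * R → ℓ ≤ L r) {ω : Ω}
    (hω : (fun i => net.point i ω) ∈ threeInterferers R lam) :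
    ENNReal.ofReal ℓ * net.annulusGain R lam ω ≤ net.interferenceE L lam ω := by
  have hsd : net.servingDist lam ω < R := by
    have h1 : pointCount (discUpTo R lam) (fun i => net.point i ω) ≠ 0 :=
      (zero_lt_one.trans_le hω.1).ne'
    have h2 : ∃ i, net.point i ω ∈ discUpTo R lam := by
      by_contra hcon
      push Not at hcon
      exact h1 (ENNReal.tsum_eq_zero.2 fun i => by simp [hcon i])
    obtain ⟨i, hi⟩ := h2
    exact (net.servingDist_le hi.2).trans_lt (mem_ball_zero_iff.1 hi.1)
  unfold annulusGain markedSum interferenceE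
  rw [← ENNReal.tsum_mul_left]
  refine ENNReal.tsum_le_tsum fun i => ?_
  by_cases hi : net.point i ω ∈ annulusUpTo R lam
  · have hn : R ≤ ‖net.X i ω‖ := by
      have := hi.1.2
      rw [mem_ball_zero_iff, not_lt] at this
      exact this
    have hn2 : ‖net.X i ω‖ < 2 * R := mem_ball_zero_iff.1 hi.1.1
    have hmem : i ∈ net.interferers lam ω := ⟨hi.2, hsd.trans_le hn⟩
    rw [Set.indicator_of_mem hi, Set.indicator_of_mem hmem, Pi.one_apply, one_mul]
    gcongr
    exact hℓ _ hn hn2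
  · rw [Set.indicator_of_notMem hi]
    simp

theorem lintegral_mul_inv_annulusGain_sq_le [IsProbabilityMeasure P] {R lam : ℝ}
    {D : Set (ℕ → EuclideanSpace ℝ (Fin 2) × ℝ)} (hD : MeasurableSet D)
    (hDR : D ⊆ threeInterferers R lam) {φ : (ℕ → ℂ) → ℝ≥0∞} (hφ : Measurable φ) :
    ∫⁻ ω, D.indicator 1 (fun i => net.point i ω) *
        (φ (fun k => net.f k ω) * (net.annulusGain R lam ω ^ 2)⁻¹) ∂P ≤
      10 * (∫⁻ ω, φ (fun k => net.f k ω) ∂P) *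
        ∫⁻ ω, D.indicator 1 (fun i => net.point i ω) *
          ((pointCount (annulusUpTo R lam) (fun i => net.point i ω) + 1) *
            (pointCount (annulusUpTo R lam) (fun i => net.point i ω) + 2))⁻¹ ∂P :=
  lintegral_indicator_mul_inv_markedSum_sq_le net.measurable_point_apply net.measurable_f_apply
    net.measurable_powerGain net.powerGain_nonneg net.iIndepFun_powerGain
    (fun i _ hs => net.lintegral_exp_neg_powerGain i hs) net.indepFun_point_channels
    net.indepFun_f_powerGain (measurableSet_annulusUpTo R lam) hD
    (fun _ hz => (hDR hz).2) hφ

theorem lintegral_inv_pointCount_le {R lam : ℝ} (hR : 0 < R) (hlam : 0 < lam) :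
    ∫⁻ ω, ((pointCount (annulusUpTo R lam) (fun i => net.point i ω) + 1) *
            (pointCount (annulusUpTo R lam) (fun i => net.point i ω) + 2))⁻¹ ∂P ≤
      (ENNReal.ofReal (lam * R ^ 2) ^ 2)⁻¹ := by
  have hA := levelIntensity_annulusUpTo hR.le hlam.le
  have hAt : levelIntensity (annulusUpTo R lam) ≠ ∞ := by rw [hA]; exact ENNReal.ofReal_ne_top
  have hpi := Real.pi_gt_three
  have hq : 0 < R ^ 2 * lam := by positivity
  have hA0 : levelIntensity (annulusUpTo R lam) ≠ 0 := by
    rw [hA]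
    exact (ENNReal.ofReal_pos.2 (by positivity)).ne'
  have h1 := net.isPoissonProcess_point.lintegral_comp_pointCount (measurableSet_annulusUpTo R lam)
    hAt (F := fun x => ((x + 1) * (x + 2))⁻¹) (by fun_prop)
  have h2 := lintegral_inv_poissonMeasure_le (ENNReal.toNNReal_ne_zero.2 ⟨hA0, hAt⟩)
  push_cast at h2
  rw [h1]
  refine h2.trans (ENNReal.inv_le_inv.2 ?_)
  rw [ENNReal.coe_toNNReal hAt, hA]
  have : lam * R ^ 2 ≤ 3 * Real.pi * R ^ 2 * lam := by nlinarith
  gcongr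

/-- Configurations that have three interferers at scale `R j`, but not at the preceding scale. These
sets need not be disjoint, but they cover all configurations that have three interferers at some
scale. -/
def firstThree (R : ℕ → ℝ) (lam : ℝ) : ℕ → Set (ℕ → EuclideanSpace ℝ (Fin 2) × ℝ)
  | 0 => threeInterferers (R 0) lam
  | j + 1 => threeInterferers (R (j + 1)) lam \ threeInterferers (R j) lam

theorem measurableSet_firstThree (R : ℕ → ℝ) (lam : ℝ) (j : ℕ) :
    MeasurableSet (firstThree R lam j) := by
  cases j with
  | zero => exact measurableSet_threeInterferers _ _
  | succ j => exact (measurableSet_threeInterferers _ _).diff (measurableSet_threeInterferers _ _)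

theorem firstThree_subset (R : ℕ → ℝ) (lam : ℝ) (j : ℕ) :
    firstThree R lam j ⊆ threeInterferers (R j) lam := by
  cases j with
  | zero => exact subset_rfl
  | succ j => exact Set.sdiff_subset

theorem exists_mem_firstThree {R : ℕ → ℝ} {lam : ℝ} {z : ℕ → EuclideanSpace ℝ (Fin 2) × ℝ}
    (h : ∃ j, z ∈ threeInterferers (R j) lam) : ∃ j, z ∈ firstThree R lam j := by
  classical
  refine ⟨Nat.find h, ?_⟩
  have h1 := Nat.find_spec h
  have h2 : ∀ m < Nat.find h, z ∉ threeInterferers (R m) lam := fun m hm => Nat.find_min h hm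
  generalize Nat.find h = n at h1 h2
  cases n with
  | zero => exact h1
  | succ n => exact ⟨h1, h2 n n.lt_succ_self⟩

/-- Bound on the mean inverse square of the interference, over configurations in which the nearest
three interferers are found at the scale `R j`. -/
theorem lintegral_mul_inv_interferenceE_sq_le_tsum [IsProbabilityMeasure P] {L : ℝ → ℝ}
    {R ℓ : ℕ → ℝ} (hR : ∀ j, 0 < R j) (hℓ0 : ∀ j, 0 < ℓ j)
    (hℓ : ∀ j r, R j ≤ r → r < 2 * R j → ℓ j ≤ L r) {lam : ℝ} (hlam : 0 < lam)
    (hlim : Tendsto (fun j => 5 * Real.exp (-(lam * R j ^ 2))) atTop (𝓝 0))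
    {φ : (ℕ → ℂ) → ℝ≥0∞} (hφ : Measurable φ) :
    ∫⁻ ω, φ (fun k => net.f k ω) * (net.interferenceE L lam ω ^ 2)⁻¹ ∂P ≤
      (∫⁻ ω, φ (fun k => net.f k ω) ∂P) *
        (ENNReal.ofReal (10 / (ℓ 0 * (lam * R 0 ^ 2)) ^ 2) +
          ∑' j, ENNReal.ofReal (50 / ℓ (j + 1) ^ 2 * Real.exp (-(lam * R j ^ 2)))) := by
  have hex : ∀ᵐ ω ∂P, ∃ j, (fun i => net.point i ω) ∈ threeInterferers (R j) lam := by
    rw [ae_iff]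
    push Not
    refine le_antisymm (ge_of_tendsto' (x := atTop) (f := fun j =>
      ENNReal.ofReal (5 * Real.exp (-(lam * R j ^ 2)))) ?_ fun j => ?_) zero_le
    · rw [← ENNReal.ofReal_zero]
      exact (ENNReal.continuous_ofReal.tendsto 0).comp hlim
    · exact (measure_mono (Set.ofPred_subset_ofPred.2 fun ω hω => hω j)).trans
        (net.measure_compl_threeInterferers_le (hR j).le hlam.le)
  have hDm : ∀ j, Measurable fun ω => (firstThree R lam j).indicator
      (1 : (ℕ → EuclideanSpace ℝ (Fin 2) × ℝ) → ℝ≥0∞) fun i => net.point i ω := fun j => by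
    have h : Measurable ((firstThree R lam j).indicator
        (1 : (ℕ → EuclideanSpace ℝ (Fin 2) × ℝ) → ℝ≥0∞)) :=
      measurable_const.indicator (measurableSet_firstThree R lam j)
    exact h.comp net.measurable_point_apply
  have hφm : Measurable fun ω => φ fun k => net.f k ω := hφ.comp net.measurable_f_apply
  have hterm : ∀ j, Measurable fun ω => (firstThree R lam j).indicator
      (1 : (ℕ → EuclideanSpace ℝ (Fin 2) × ℝ) → ℝ≥0∞) (fun i => net.point i ω) *
      (φ (fun k => net.f k ω) * (net.annulusGain (R j) lam ω ^ 2)⁻¹) := fun j =>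
    (hDm j).mul (hφm.mul ((net.measurable_annulusGain (R j) lam).pow_const 2).inv)
  have hpt : ∀ᵐ ω ∂P, φ (fun k => net.f k ω) * (net.interferenceE L lam ω ^ 2)⁻¹ ≤
      ∑' j, (ENNReal.ofReal (ℓ j) ^ 2)⁻¹ * ((firstThree R lam j).indicator 1
        (fun i => net.point i ω) *
          (φ (fun k => net.f k ω) * (net.annulusGain (R j) lam ω ^ 2)⁻¹)) := by
    filter_upwards [hex] with ω hω
    obtain ⟨j, hj⟩ := exists_mem_firstThree hω
    refine le_trans ?_ (ENNReal.le_tsum j)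
    have hle := net.mul_annulusGain_le_interferenceE (hℓ j) (firstThree_subset R lam j hj)
    have hpos : ENNReal.ofReal (ℓ j) ^ 2 ≠ 0 := pow_ne_zero _ (ENNReal.ofReal_pos.2 (hℓ0 j)).ne'
    have htop : ENNReal.ofReal (ℓ j) ^ 2 ≠ ∞ := ENNReal.pow_ne_top ENNReal.ofReal_ne_top
    rw [Set.indicator_of_mem hj, Pi.one_apply, one_mul, mul_left_comm,
      ← ENNReal.mul_inv (Or.inl hpos) (Or.inl htop), ← mul_pow]
    gcongr
  refine (lintegral_mono_ae hpt).trans ?_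
  rw [lintegral_tsum fun j => ((hterm j).const_mul _).aemeasurable,
    tsum_eq_zero_add' ENNReal.summable, mul_add, ← ENNReal.tsum_mul_left]
  have hinv : ∀ j, (ENNReal.ofReal (ℓ j) ^ 2)⁻¹ = ENNReal.ofReal (1 / ℓ j ^ 2) := fun j => by
    have := hℓ0 j
    rw [← ENNReal.ofReal_pow this.le, ← ENNReal.ofReal_inv_of_pos (by positivity), one_div]
  have hten : (10 : ℝ≥0∞) = ENNReal.ofReal 10 := by norm_num
  refine add_le_add ?_ (ENNReal.tsum_le_tsum fun j => ?_)
  · rw [lintegral_const_mul _ (hterm 0)]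
    have h1 := net.lintegral_mul_inv_annulusGain_sq_le (measurableSet_firstThree R lam 0)
      (firstThree_subset R lam 0) hφ
    have h2 : ∫⁻ ω, (firstThree R lam 0).indicator 1 (fun i => net.point i ω) *
          ((pointCount (annulusUpTo (R 0) lam) (fun i => net.point i ω) + 1) *
            (pointCount (annulusUpTo (R 0) lam) (fun i => net.point i ω) + 2))⁻¹ ∂P ≤
        (ENNReal.ofReal (lam * R 0 ^ 2) ^ 2)⁻¹ := by
      refine le_trans (lintegral_mono fun ω => ?_) (net.lintegral_inv_pointCount_le (hR 0) hlam)
      exact mul_le_of_le_one_left' (Set.indicator_le' (fun _ _ => le_rfl)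
        (fun _ _ => zero_le_one) _)
    have hR0 := hR 0
    have hl0 := hℓ0 0
    calc _ ≤ (ENNReal.ofReal (ℓ 0) ^ 2)⁻¹ * (10 * (∫⁻ ω, φ (fun k => net.f k ω) ∂P) *
          (ENNReal.ofReal (lam * R 0 ^ 2) ^ 2)⁻¹) := by
          gcongr
          exact h1.trans (by gcongr)
      _ = _ := by
        have : ENNReal.ofReal (10 / (ℓ 0 * (lam * R 0 ^ 2)) ^ 2) =
            10 * ((ENNReal.ofReal (ℓ 0) ^ 2)⁻¹ * (ENNReal.ofReal (lam * R 0 ^ 2) ^ 2)⁻¹) := by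
          rw [hinv 0, ← ENNReal.ofReal_pow (by positivity),
            ← ENNReal.ofReal_inv_of_pos (by positivity), hten,
            ← ENNReal.ofReal_mul (by positivity), ← ENNReal.ofReal_mul (by positivity)]
          congr 1
          field_simp
        rw [this]
        ring
  · rw [lintegral_const_mul _ (hterm (j + 1))]
    have h1 := net.lintegral_mul_inv_annulusGain_sq_le (measurableSet_firstThree R lam (j + 1))
      (firstThree_subset R lam (j + 1)) hφ
    have h2 : ∫⁻ ω, (firstThree R lam (j + 1)).indicator 1 (fun i => net.point i ω) *
          ((pointCount (annulusUpTo (R (j + 1)) lam) (fun i => net.point i ω) + 1) *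
            (pointCount (annulusUpTo (R (j + 1)) lam) (fun i => net.point i ω) + 2))⁻¹ ∂P ≤
        ENNReal.ofReal (5 * Real.exp (-(lam * R j ^ 2))) := by
      refine le_trans ?_ (net.measure_compl_threeInterferers_le (hR j).le hlam.le)
      have hmeas : MeasurableSet {ω | (fun i => net.point i ω) ∉ threeInterferers (R j) lam} :=
        (net.measurable_point_apply (measurableSet_threeInterferers (R j) lam)).compl
      rw [← lintegral_indicator_one hmeas]
      refine lintegral_mono fun ω => ?_
      by_cases hz : (fun i => net.point i ω) ∈ firstThree R lam (j + 1)
      · rw [Set.indicator_of_mem hz, Set.indicator_of_mem (show ω ∈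
          {ω | (fun i => net.point i ω) ∉ threeInterferers (R j) lam} from hz.2),
          Pi.one_apply, one_mul, Pi.one_apply]
        refine ENNReal.inv_le_one.2 ?_
        exact one_le_mul le_add_self (one_le_two.trans le_add_self)
      · rw [Set.indicator_of_notMem hz, zero_mul]
        exact zero_le
    have hl := hℓ0 (j + 1)
    calc _ ≤ (ENNReal.ofReal (ℓ (j + 1)) ^ 2)⁻¹ * (10 * (∫⁻ ω, φ (fun k => net.f k ω) ∂P) *
          ENNReal.ofReal (5 * Real.exp (-(lam * R j ^ 2)))) := by
          gcongr
          exact h1.trans (by gcongr)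
      _ = _ := by
        have : ENNReal.ofReal (50 / ℓ (j + 1) ^ 2 * Real.exp (-(lam * R j ^ 2))) =
            10 * ((ENNReal.ofReal (ℓ (j + 1)) ^ 2)⁻¹ *
              ENNReal.ofReal (5 * Real.exp (-(lam * R j ^ 2)))) := by
          rw [hinv, hten, ← ENNReal.ofReal_mul (by positivity),
            ← ENNReal.ofReal_mul (by positivity)]
          congr 1
          field_simp
          norm_num
        rw [this]
        ring

/-- The inverse square of the interference is at most of order `lam⁻²` in mean. The scales are
`R j ^ 2 = R 0 ^ 2 + j s`: the probability of finding too few base stations at scale `R j` is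
`O(exp (-lam * R j ^ 2))`, which for large `lam` beats the Gaussian growth of the inverse path
loss. -/
theorem exists_lintegral_mul_inv_interferenceE_sq_le [IsProbabilityMeasure P] {L : ℝ → ℝ}
    (hL : PhysicallyFeasible L) (hL0 : ContinuousWithinAt L (Set.Ici 0) 0)
    (hT : TailCondition L) :
    ∃ C : ℝ≥0∞, C ≠ ∞ ∧ ∃ lam₁ : ℝ, 0 < lam₁ ∧ ∀ lam, lam₁ ≤ lam →
      ∀ φ : (ℕ → ℂ) → ℝ≥0∞, Measurable φ →
        ∫⁻ ω, φ (fun k => net.f k ω) * (net.interferenceE L lam ω ^ 2)⁻¹ ∂P ≤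
          C * ENNReal.ofReal (1 / lam ^ 2) * ∫⁻ ω, φ (fun k => net.f k ω) ∂P := by
  obtain ⟨ρ, a, c, hρ, ha, hc, hgauss⟩ := hT.exists_gaussian_le
  obtain ⟨R₀, hR₀, hhalf⟩ := hL.exists_half_le hL0
  have hLpos := hL.zero_pos
  -- `s ≥ ρ ^ 2` puts all scales but the first in the range of the Gaussian minorant, and
  -- `s ≥ R₀ ^ 2` makes `R j ^ 2` comparable to `j + 1` from both sides.
  set s : ℝ := ρ ^ 2 + R₀ ^ 2 with hs
  have hs0 : 0 < s := by positivity
  set R : ℕ → ℝ := fun j => √(R₀ ^ 2 + j * s) with hR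
  have hRsq : ∀ j, R j ^ 2 = R₀ ^ 2 + j * s := fun j => Real.sq_sqrt (by positivity)
  have hRpos : ∀ j, 0 < R j := fun j => Real.sqrt_pos.2 (by positivity)
  have hRzero : R 0 = R₀ := by simp [hR, hR₀.le]
  have hRρ : ∀ j, ρ ≤ R (j + 1) := fun j => by
    refine Real.le_sqrt_of_sq_le ?_
    push_cast
    nlinarith [mul_nonneg (Nat.cast_nonneg (α := ℝ) j) hs0.le, sq_nonneg R₀]
  have hRlow : ∀ j : ℕ, R₀ ^ 2 * (j + 1) ≤ R j ^ 2 := fun j => by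
    rw [hRsq]
    nlinarith [mul_nonneg (Nat.cast_nonneg (α := ℝ) j) (sq_nonneg ρ)]
  have hRup : ∀ j : ℕ, R (j + 1) ^ 2 ≤ 2 * s * (j + 1) := fun j => by
    rw [hRsq]
    push_cast
    nlinarith [mul_nonneg (Nat.cast_nonneg (α := ℝ) j) hs0.le, sq_nonneg ρ]
  set ℓ : ℕ → ℝ := fun j =>
    if j = 0 then L 0 / 2 else c * Real.exp (-(a * (2 * R j) ^ 2)) with hℓdef
  have hℓ0 : ∀ j, 0 < ℓ j := fun j => by
    rw [hℓdef]
    dsimp only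
    split_ifs <;> positivity
  have hℓ : ∀ j r, R j ≤ r → r < 2 * R j → ℓ j ≤ L r := by
    intro j r h1 h2
    have hr0 : 0 ≤ r := (hRpos j).le.trans h1
    cases j with
    | zero =>
      rw [hRzero] at h2
      exact hhalf r hr0 h2
    | succ j =>
      refine le_trans ?_ (hgauss r ((hRρ j).trans h1))
      have : ℓ (j + 1) = c * Real.exp (-(a * (2 * R (j + 1)) ^ 2)) := if_neg j.succ_ne_zero
      rw [this]
      gcongr
  set K : ℝ := 50 / c ^ 2 * (8 / R₀ ^ 4) with hK
  have hK0 : 0 ≤ K := by positivity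
  have hsum : Summable fun j : ℕ => K * (1 / ((j + 1 : ℕ) : ℝ) ^ 2) :=
    ((summable_nat_add_iff 1).2 (Real.summable_one_div_nat_pow.2 (by norm_num))).mul_left K
  refine ⟨ENNReal.ofReal (10 / (ℓ 0 * R 0 ^ 2) ^ 2) +
    ∑' j : ℕ, ENNReal.ofReal (K * (1 / ((j + 1 : ℕ) : ℝ) ^ 2)), ?_,
    max 1 (32 * a * s / R₀ ^ 2), by positivity, fun lam hlam φ hφ => ?_⟩
  · refine ENNReal.add_ne_top.2 ⟨ENNReal.ofReal_ne_top, ?_⟩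
    rw [← ENNReal.ofReal_tsum_of_nonneg (fun j => by positivity) hsum]
    exact ENNReal.ofReal_ne_top
  have hlam1 : 1 ≤ lam := (le_max_left _ _).trans hlam
  have hlam0 : 0 < lam := by linarith
  have hlam2 : 32 * a * s ≤ lam * R₀ ^ 2 := (div_le_iff₀ (by positivity)).1
    ((le_max_right _ _).trans hlam)
  have hbound : ∀ j : ℕ, 50 / ℓ (j + 1) ^ 2 * Real.exp (-(lam * R j ^ 2)) ≤
      K * (1 / ((j + 1 : ℕ) : ℝ) ^ 2) * (1 / lam ^ 2) := by
    intro j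
    have h0 : ℓ (j + 1) = c * Real.exp (-(a * (2 * R (j + 1)) ^ 2)) := if_neg j.succ_ne_zero
    have h1 : 50 / ℓ (j + 1) ^ 2 * Real.exp (-(lam * R j ^ 2)) =
        50 / c ^ 2 * Real.exp (8 * a * R (j + 1) ^ 2 - lam * R j ^ 2) := by
      have e1 : (c * Real.exp (-(a * (2 * R (j + 1)) ^ 2))) ^ 2 =
          c ^ 2 * Real.exp (-(8 * a * R (j + 1) ^ 2)) := by
        rw [mul_pow, ← Real.exp_nat_mul]
        congr 2
        push_cast
        ring
      have e2 : Real.exp (8 * a * R (j + 1) ^ 2 - lam * R j ^ 2) =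
          (Real.exp (-(8 * a * R (j + 1) ^ 2)))⁻¹ * Real.exp (-(lam * R j ^ 2)) := by
        rw [← Real.exp_neg, neg_neg, ← Real.exp_add]
        congr 1
      rw [h0, e1, e2]
      field_simp
    set x : ℝ := lam * R₀ ^ 2 * (j + 1) / 2 with hx
    have hx0 : 0 < x := by positivity
    have h2 : 8 * a * R (j + 1) ^ 2 - lam * R j ^ 2 ≤ -x := by
      have i1 : 8 * a * R (j + 1) ^ 2 ≤ 8 * a * (2 * s * (j + 1)) := by
        have := hRup j
        gcongr
      have i2 : lam * (R₀ ^ 2 * (j + 1)) ≤ lam * R j ^ 2 := by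
        have := hRlow j
        gcongr
      have i3 : 32 * a * s * (j + 1) ≤ lam * R₀ ^ 2 * (j + 1) := by gcongr
      rw [hx]
      linarith
    rw [h1]
    calc _ ≤ 50 / c ^ 2 * (2 / x ^ 2) := by
          gcongr
          exact (Real.exp_le_exp.2 h2).trans (exp_neg_le_two_div_sq hx0)
      _ = _ := by
        rw [hx, hK]
        push_cast
        field_simp
        ring
  have hlim : Tendsto (fun j => 5 * Real.exp (-(lam * R j ^ 2))) atTop (𝓝 0) := by
    have h1 : Tendsto (fun j : ℕ => lam * (R₀ ^ 2 + j * s)) atTop atTop :=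
      (tendsto_atTop_add_const_left _ _ (tendsto_natCast_atTop_atTop.atTop_mul_const
        hs0)).const_mul_atTop hlam0
    simp_rw [hRsq]
    simpa using (Real.tendsto_exp_neg_atTop_nhds_zero.comp h1).const_mul 5
  refine (net.lintegral_mul_inv_interferenceE_sq_le_tsum hRpos hℓ0 hℓ hlam0 hlim hφ).trans ?_
  rw [mul_comm (∫⁻ ω, φ (fun k => net.f k ω) ∂P), add_mul _ _ (ENNReal.ofReal _),
    ← ENNReal.tsum_mul_right]
  refine mul_le_mul_left (add_le_add (le_of_eq ?_) (ENNReal.tsum_le_tsum fun j => ?_)) _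
  · rw [← ENNReal.ofReal_mul (by positivity)]
    congr 1
    have := hℓ0 0
    have := hRpos 0
    field_simp
  · rw [← ENNReal.ofReal_mul (by positivity)]
    exact ENNReal.ofReal_le_ofReal (hbound j)

theorem ae_interferenceE_ne_top [IsProbabilityMeasure P] {L : ℝ → ℝ}
    (hL : PhysicallyFeasible L) : ∀ᵐ ω ∂P, ∀ lam, net.interferenceE L lam ω ≠ ∞ := by
  filter_upwards [net.ae_tendsto_markedSum_point (hL.measurable_farGain (-1))
    (by rw [hL.lintegral_farGain]; exact ENNReal.ofReal_ne_top)
    (hL.lintegral_farGain_sq_ne_top (-1))] with ω hω lam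
  exact ne_top_of_le_ne_top (hω.1 lam) (net.interferenceE_le L lam ω)

/-- The square of the received signal power per antenna, as a function of the channel
coefficients. -/
noncomputable def signalSq (N : ℕ) (x : ℕ → ℂ) : ℝ≥0∞ :=
  ENNReal.ofReal (((∑ k ∈ Finset.range N, ‖x k‖ ^ 2) / N) ^ 2)

theorem measurable_signalSq (N : ℕ) : Measurable (signalSq N) := by
  unfold signalSq
  fun_prop

theorem lintegral_signalSq_le {N : ℕ} (hN : 1 ≤ N) :
    ∫⁻ ω, signalSq N (fun k => net.f k ω) ∂P ≤ powerSecondMoment := by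
  have hN0 : (0 : ℝ) < N := by exact_mod_cast hN
  have hpt : ∀ ω, signalSq N (fun k => net.f k ω) ≤
      ENNReal.ofReal (1 / N) * ∑ k ∈ Finset.range N, ENNReal.ofReal (‖net.f k ω‖ ^ 2) ^ 2 := by
    intro ω
    unfold signalSq
    simp_rw [← ENNReal.ofReal_pow (sq_nonneg _)]
    rw [← ENNReal.ofReal_sum_of_nonneg (fun k _ => by positivity),
      ← ENNReal.ofReal_mul (by positivity)]
    refine ENNReal.ofReal_le_ofReal ?_
    have h := sq_sum_le_card_mul_sum_sq (s := Finset.range N) (f := fun k => ‖net.f k ω‖ ^ 2)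
    rw [Finset.card_range] at h
    rw [div_pow, div_le_iff₀ (by positivity)]
    refine h.trans (le_of_eq ?_)
    field_simp
  have hm : ∀ k, Measurable fun ω => ENNReal.ofReal (‖net.f k ω‖ ^ 2) ^ 2 := fun k => by
    have := net.measurable_f k
    fun_prop
  have hk : ∀ k, ∫⁻ ω, ENNReal.ofReal (‖net.f k ω‖ ^ 2) ^ 2 ∂P = powerSecondMoment := fun k =>
    (net.law_f k).lintegral_comp (f := fun z => ENNReal.ofReal (‖z‖ ^ 2) ^ 2) (by fun_prop)
  refine (lintegral_mono hpt).trans (le_of_eq ?_)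
  rw [lintegral_const_mul _ (Finset.measurable_fun_sum _ fun k _ => hm k),
    lintegral_finsetSum _ fun k _ => hm k]
  simp_rw [hk]
  rw [Finset.sum_const, Finset.card_range, nsmul_eq_mul, ← mul_assoc, ← ENNReal.ofReal_natCast N,
    ← ENNReal.ofReal_mul (by positivity), one_div_mul_cancel hN0.ne', ENNReal.ofReal_one, one_mul]

theorem interference_nonneg {L : ℝ → ℝ} (hL : PhysicallyFeasible L) (N : ℕ) (lam : ℝ) (ω : Ω) :
    0 ≤ net.interference L N lam ω :=
  tsum_nonneg fun _ => Set.indicator_nonneg (fun _ _ =>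
    mul_nonneg (hL.nonneg _ (norm_nonneg _)) (sq_nonneg _)) _

theorem sinr_nonneg {L : ℝ → ℝ} (hL : PhysicallyFeasible L) (σ : ℝ) (N : ℕ) (lam : ℝ) (ω : Ω) :
    0 ≤ net.sinr L σ N lam ω :=
  div_nonneg (mul_nonneg (hL.nonneg _ (net.servingDist_nonneg lam ω)) (sq_nonneg _))
    (add_nonneg (net.interference_nonneg hL N lam ω) (sq_nonneg _))

theorem ae_sinr_sq_le [IsProbabilityMeasure P] {L : ℝ → ℝ} (hL : PhysicallyFeasible L) (σ : ℝ)
    {N : ℕ} (hN : 1 ≤ N) {lam : ℝ} (hlam : 0 < lam) :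
    ∀ᵐ ω ∂P, ENNReal.ofReal ((lam / N * net.sinr L σ N lam ω) ^ 2) ≤
      ENNReal.ofReal ((L 0 * lam) ^ 2) *
        (signalSq N (fun k => net.f k ω) * (net.interferenceE L lam ω ^ 2)⁻¹) := by
  filter_upwards [net.ae_interference_eq hL, net.ae_interferenceE_ne_top hL] with ω hI hfin
  have hN0 : (0 : ℝ) < N := by exact_mod_cast hN
  have hLpos := hL.zero_pos
  set I := net.interferenceE L lam ω with hIdef
  set d := L (net.servingDist lam ω) with hd
  have hd0 : 0 ≤ d := hL.nonneg _ (net.servingDist_nonneg lam ω)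
  have hdle : d ≤ L 0 := hL.le_zero _ (net.servingDist_nonneg lam ω)
  set S : ℝ := ∑ k ∈ Finset.range N, ‖net.f k ω‖ ^ 2 with hS
  have hS0 : 0 ≤ S := Finset.sum_nonneg fun _ _ => sq_nonneg _
  have hsinr : net.sinr L σ N lam ω = d * S / (I.toReal + σ ^ 2) := by
    unfold sinr
    rw [gain_mrt_self, hI lam N hN, norm_hServ_sq]
  have hsig : signalSq N (fun k => net.f k ω) = ENNReal.ofReal ((S / N) ^ 2) := rfl
  rw [hsinr, hsig]
  rcases hS0.eq_or_lt with hS0 | hS0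
  · simp [← hS0]
  by_cases hI0 : I = 0
  · -- Without interference the right-hand side is infinite.
    have h1 : ENNReal.ofReal ((S / N) ^ 2) ≠ 0 := (ENNReal.ofReal_pos.2 (by positivity)).ne'
    have h2 : ENNReal.ofReal ((L 0 * lam) ^ 2) ≠ 0 := (ENNReal.ofReal_pos.2 (by positivity)).ne'
    rw [hI0, zero_pow two_ne_zero, ENNReal.inv_zero, ENNReal.mul_top h1, ENNReal.mul_top h2]
    exact le_top
  · have hIr : 0 < I.toReal := ENNReal.toReal_pos hI0 (hfin lam)
    have hIe : (I ^ 2)⁻¹ = ENNReal.ofReal ((I.toReal ^ 2)⁻¹) := by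
      rw [ENNReal.ofReal_inv_of_pos (by positivity), ENNReal.ofReal_pow hIr.le,
        ENNReal.ofReal_toReal (hfin lam)]
    rw [hIe, ← ENNReal.ofReal_mul (by positivity), ← ENNReal.ofReal_mul (by positivity)]
    refine ENNReal.ofReal_le_ofReal ?_
    calc (lam / N * (d * S / (I.toReal + σ ^ 2))) ^ 2
        ≤ (lam / N * (L 0 * S / I.toReal)) ^ 2 := by
          gcongr
          exact le_add_of_nonneg_right (sq_nonneg σ)
      _ = _ := by field_simp

theorem exists_lintegral_sinr_sq_le [IsProbabilityMeasure P] {L : ℝ → ℝ}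
    (hL : PhysicallyFeasible L) (hL0 : ContinuousWithinAt L (Set.Ici 0) 0)
    (hT : TailCondition L) (σ : ℝ) :
    ∃ C : ℝ≥0∞, C ≠ ∞ ∧ ∃ lam₁ : ℝ, ∀ lam, lam₁ ≤ lam → ∀ N : ℕ, 1 ≤ N →
      ∫⁻ ω, ENNReal.ofReal ((lam / N * net.sinr L σ N lam ω) ^ 2) ∂P ≤ C := by
  obtain ⟨C, hC, lam₁, hlam₁, h⟩ := net.exists_lintegral_mul_inv_interferenceE_sq_le hL hL0 hT
  refine ⟨ENNReal.ofReal (L 0 ^ 2) * (C * powerSecondMoment), ENNReal.mul_ne_top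
    ENNReal.ofReal_ne_top (ENNReal.mul_ne_top hC powerSecondMoment_ne_top), lam₁,
    fun lam hlam N hN => ?_⟩
  have hlam0 : 0 < lam := hlam₁.trans_le hlam
  refine (lintegral_mono_ae (net.ae_sinr_sq_le hL σ hN hlam0)).trans ?_
  rw [lintegral_const_mul' _ _ ENNReal.ofReal_ne_top]
  calc _ ≤ ENNReal.ofReal ((L 0 * lam) ^ 2) *
        (C * ENNReal.ofReal (1 / lam ^ 2) * powerSecondMoment) := by
        gcongr
        exact (h lam hlam _ (measurable_signalSq N)).trans (by
          gcongr
          exact net.lintegral_signalSq_le hN)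
    _ = _ := by
      have : ENNReal.ofReal (L 0 ^ 2) =
          ENNReal.ofReal ((L 0 * lam) ^ 2) * ENNReal.ofReal (1 / lam ^ 2) := by
        rw [← ENNReal.ofReal_mul (by positivity)]
        congr 1
        field_simp
      rw [this]
      ring

/-! ### Measurability of the SINR -/

theorem servingDist_eq_toReal_iInf (lam : ℝ) (ω : Ω) :
    net.servingDist lam ω =
      (⨅ i, if net.T i ω ≤ lam then ENNReal.ofReal ‖net.X i ω‖ else ∞).toReal := by
  by_cases h : ∃ i, net.T i ω ≤ lam
  · obtain ⟨j, hj⟩ := h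
    have hfin : (⨅ i, if net.T i ω ≤ lam then ENNReal.ofReal ‖net.X i ω‖ else ∞) ≠ ∞ :=
      ne_top_of_le_ne_top ENNReal.ofReal_ne_top ((iInf_le _ j).trans (if_pos hj).le)
    refine le_antisymm ?_ (le_csInf ⟨_, j, hj, rfl⟩ ?_)
    · rw [← ENNReal.ofReal_le_iff_le_toReal hfin]
      refine le_iInf fun i => ?_
      split_ifs with hi
      · exact ENNReal.ofReal_le_ofReal (net.servingDist_le hi)
      · exact le_top
    · rintro _ ⟨i, hi, rfl⟩
      have hi' : net.T i ω ≤ lam := hi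
      exact ENNReal.toReal_le_of_le_ofReal (norm_nonneg _)
        ((iInf_le _ i).trans (if_pos hi').le)
  · -- No base station is present: both sides are `0`.
    have h' : {i | net.T i ω ≤ lam} = ∅ :=
      Set.eq_empty_iff_forall_notMem.2 fun i hi => h ⟨i, hi⟩
    push Not at h
    have h2 : ∀ i, (if net.T i ω ≤ lam then ENNReal.ofReal ‖net.X i ω‖ else ∞) = ∞ := fun i =>
      if_neg (not_le.2 (h i))
    simp_rw [h2]
    rw [servingDist, h']
    simp

theorem measurable_X (i : ℕ) : Measurable (net.X i) :=
  measurable_fst.comp (net.poisson.measurable i)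

theorem measurable_T (i : ℕ) : Measurable (net.T i) :=
  measurable_snd.comp (net.poisson.measurable i)

theorem measurable_servingDist (lam : ℝ) : Measurable (net.servingDist lam) := by
  have h : net.servingDist lam = fun ω =>
      (⨅ i, if net.T i ω ≤ lam then ENNReal.ofReal ‖net.X i ω‖ else ∞).toReal :=
    funext fun ω => net.servingDist_eq_toReal_iInf lam ω
  rw [h]
  exact (Measurable.iInf fun i => Measurable.ite (measurableSet_le (net.measurable_T i)
    measurable_const) (net.measurable_X i).norm.ennreal_ofReal measurable_const).ennreal_toReal

theorem measurable_interferenceE {L : ℝ → ℝ} (hL : Measurable L) (lam : ℝ) :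
    Measurable (net.interferenceE L lam) := by
  classical
  have h : net.interferenceE L lam = fun ω => ∑' i,
      if net.T i ω ≤ lam ∧ net.servingDist lam ω < ‖net.X i ω‖ then
        ENNReal.ofReal (L ‖net.X i ω‖) * ENNReal.ofReal (net.powerGain i ω) else 0 := by
    funext ω
    refine tsum_congr fun i => ?_
    simp only [Set.indicator_apply, interferers, Set.mem_ofPred_eq]
  rw [h]
  refine Measurable.tsum fun i => Measurable.ite ?_ ?_ measurable_const
  · exact (measurableSet_le (net.measurable_T i) measurable_const).inter
      (measurableSet_lt (net.measurable_servingDist lam) (net.measurable_X i).norm)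
  · exact (hL.comp (net.measurable_X i).norm).ennreal_ofReal.mul
      (net.measurable_powerGain i).ennreal_ofReal

theorem aemeasurable_sinr {L : ℝ → ℝ} (hL : PhysicallyFeasible L) (σ : ℝ) {N : ℕ} (hN : 1 ≤ N)
    (lam : ℝ) : AEMeasurable (net.sinr L σ N lam) P := by
  have hS : Measurable fun ω => ∑ k ∈ Finset.range N, ‖net.f k ω‖ ^ 2 :=
    Finset.measurable_fun_sum _ fun k _ => (net.measurable_f k).norm.pow_const 2
  refine ⟨fun ω => L (net.servingDist lam ω) * (∑ k ∈ Finset.range N, ‖net.f k ω‖ ^ 2) /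
      ((net.interferenceE L lam ω).toReal + σ ^ 2),
    ((hL.measurable.comp (net.measurable_servingDist lam)).mul hS).div
      ((net.measurable_interferenceE hL.measurable lam).ennreal_toReal.add_const _), ?_⟩
  filter_upwards [net.ae_interference_eq hL] with ω hω
  unfold sinr
  rw [gain_mrt_self, norm_hServ_sq, hω lam N hN]

end Network

/-! ### Convergence of expectations -/

section Vitali

variable {Ω : Type*} [MeasurableSpace Ω] {P : Measure Ω} [IsProbabilityMeasure P]

theorem integrable_of_lintegral_sq_le {W : Ω → ℝ} (hW : AEMeasurable W P) {C : ℝ≥0∞} (hC : C ≠ ∞)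
    (h : ∫⁻ ω, ENNReal.ofReal (W ω ^ 2) ∂P ≤ C) :
    Integrable W P ∧ Integrable (fun ω => W ω ^ 2) P ∧ ∫ ω, W ω ^ 2 ∂P ≤ C.toReal := by
  have hsq : Integrable (fun ω => W ω ^ 2) P :=
    (lintegral_ofReal_ne_top_iff_integrable (hW.pow_const 2).aestronglyMeasurable
      (ae_of_all _ fun ω => sq_nonneg _)).1 (ne_top_of_le_ne_top hC h)
  refine ⟨((memLp_two_iff_integrable_sq hW.aestronglyMeasurable).2 hsq).integrable one_le_two,
    hsq, ?_⟩
  rw [integral_eq_lintegral_of_nonneg_ae (ae_of_all _ fun ω => sq_nonneg _)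
    hsq.aestronglyMeasurable]
  exact ENNReal.toReal_mono hC h

/-- Almost sure convergence to a constant together with a bound on second moments gives
convergence of expectations: the part of `W` above the level `M` has mean at most `C / M`. -/
theorem tendsto_integral_of_lintegral_sq_le {W : ℝ → Ω → ℝ} {c : ℝ}
    (hW : ∀ᶠ x in atTop, AEMeasurable (W x) P) (hW0 : ∀ᶠ x in atTop, ∀ ω, 0 ≤ W x ω)
    {C : ℝ≥0∞} (hC : C ≠ ∞) (h : ∀ᶠ x in atTop, ∫⁻ ω, ENNReal.ofReal (W x ω ^ 2) ∂P ≤ C)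
    (hlim : ∀ᵐ ω ∂P, Tendsto (fun x => W x ω) atTop (𝓝 c)) :
    Tendsto (fun x => ∫ ω, W x ω ∂P) atTop (𝓝 c) := by
  have htrunc : ∀ M, 0 < M → c < M → Tendsto (fun x => ∫ ω, min (W x ω) M ∂P) atTop (𝓝 c) := by
    intro M hM hcM
    have h1 : Tendsto (fun x => ∫ ω, min (W x ω) M ∂P) atTop (𝓝 (∫ _, c ∂P)) := by
      refine tendsto_integral_filter_of_dominated_convergence (fun _ => M) ?_ ?_
        (integrable_const M) ?_
      · filter_upwards [hW] with x hx
        exact (hx.min aemeasurable_const).aestronglyMeasurable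
      · filter_upwards [hW0] with x hx
        refine ae_of_all _ fun ω => ?_
        rw [Real.norm_eq_abs, abs_of_nonneg (le_min (hx ω) hM.le)]
        exact min_le_right _ _
      · filter_upwards [hlim] with ω hω
        have := hω.min (tendsto_const_nhds (x := M))
        rwa [min_eq_left hcM.le] at this
    simpa using h1
  have hint : ∀ M, 0 < M → ∀ᶠ x in atTop, ∫ ω, min (W x ω) M ∂P ≤ ∫ ω, W x ω ∂P ∧
      ∫ ω, W x ω ∂P ≤ ∫ ω, min (W x ω) M ∂P + C.toReal / M := by
    intro M hM
    filter_upwards [hW, hW0, h] with x hx hx0 hxC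
    obtain ⟨i1, i2, i3⟩ := integrable_of_lintegral_sq_le hx hC hxC
    have i4 : Integrable (fun ω => min (W x ω) M) P := i1.inf (integrable_const M)
    refine ⟨integral_mono i4 i1 fun ω => min_le_left _ _, ?_⟩
    calc ∫ ω, W x ω ∂P ≤ ∫ ω, (min (W x ω) M + W x ω ^ 2 / M) ∂P := by
          refine integral_mono i1 (i4.add (i2.div_const M)) fun ω => ?_
          have hw := hx0 ω
          rcases le_total (W x ω) M with hle | hle
          · simp only [min_eq_left hle]
            have : 0 ≤ W x ω ^ 2 / M := by positivity
            linarith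
          · simp only [min_eq_right hle]
            have : W x ω ≤ W x ω ^ 2 / M := by
              rw [le_div_iff₀ hM]
              nlinarith
            linarith
      _ = ∫ ω, min (W x ω) M ∂P + (∫ ω, W x ω ^ 2 ∂P) / M := by
          rw [integral_add i4 (i2.div_const M), integral_div]
      _ ≤ _ := by gcongr
  refine tendsto_order.2 ⟨fun a ha => ?_, fun a ha => ?_⟩
  · have hM : 0 < |c| + 1 := by positivity
    filter_upwards [(htrunc _ hM (by linarith [le_abs_self c])).eventually (lt_mem_nhds ha),
      hint _ hM] with x h1 h2
    exact h1.trans_le h2.1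
  · set δ := (a - c) / 2 with hδ
    have hδ0 : 0 < δ := by rw [hδ]; linarith
    set M := |c| + 1 + C.toReal / δ with hMdef
    have hC0 : 0 ≤ C.toReal / δ := by positivity
    have hM : 0 < M := by positivity
    have hcM : c < M := by linarith [le_abs_self c]
    have hCM : C.toReal / M ≤ δ := by
      rw [div_le_iff₀ hM, ← div_le_iff₀' hδ0]
      linarith [abs_nonneg c]
    filter_upwards [(htrunc _ hM hcM).eventually (gt_mem_nhds (show c < a - δ by
      rw [hδ]; linarith)), hint _ hM] with x h1 h2
    linarith [h2.2]

end Vitali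

end MISO

theorem theorem1 {Ω : Type*} [MeasurableSpace Ω] (P : Measure Ω) [IsProbabilityMeasure P]
    (net : MISO.Network P) (L : ℝ → ℝ) (hL : MISO.PhysicallyFeasible L)
    (hL0 : ContinuousWithinAt L (Set.Ici 0) 0) (σ : ℝ)
    (Nt : ℝ → ℕ) (hNt_mono : MonotoneOn Nt (Set.Ioi 0)) (hNt : Tendsto Nt atTop atTop) :
    (∀ᵐ ω ∂P, Tendsto (fun lam : ℝ => lam / (Nt lam : ℝ) * net.sinr L σ (Nt lam) lam ω) atTop
      (𝓝 (L 0 / (2 * Real.pi * MISO.gammaConst L)))) ∧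
    (Tendsto (fun lam : ℝ => lam / (Nt lam : ℝ)) atTop atTop →
      ∀ᵐ ω ∂P, Tendsto (fun lam : ℝ => net.sinr L σ (Nt lam) lam ω) atTop (𝓝 0) ∧
        (fun lam : ℝ => net.sinr L σ (Nt lam) lam ω) ~[atTop]
          fun lam : ℝ => L 0 / (2 * Real.pi * MISO.gammaConst L) * (lam / (Nt lam : ℝ))⁻¹) ∧
    (∀ c : ℝ, 0 < c → Tendsto (fun lam : ℝ => lam / (Nt lam : ℝ)) atTop (𝓝 c) →
      ∀ᵐ ω ∂P, Tendsto (fun lam : ℝ => net.sinr L σ (Nt lam) lam ω) atTop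
        (𝓝 (L 0 / (2 * Real.pi * MISO.gammaConst L * c)))) ∧
    (Tendsto (fun lam : ℝ => lam / (Nt lam : ℝ)) atTop (𝓝 0) →
      ∀ᵐ ω ∂P, Tendsto (fun lam : ℝ => net.sinr L σ (Nt lam) lam ω) atTop atTop ∧
        (fun lam : ℝ => net.sinr L σ (Nt lam) lam ω) ~[atTop]
          fun lam : ℝ => L 0 / (2 * Real.pi * MISO.gammaConst L) * ((Nt lam : ℝ) / lam)) ∧
    (MISO.TailCondition L →
      (∀ᶠ lam : ℝ in atTop,
        Integrable (fun ω => lam / (Nt lam : ℝ) * net.sinr L σ (Nt lam) lam ω) P) ∧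
      Tendsto (fun lam : ℝ => ∫ ω, lam / (Nt lam : ℝ) * net.sinr L σ (Nt lam) lam ω ∂P) atTop
        (𝓝 (L 0 / (2 * Real.pi * MISO.gammaConst L)))) := by
  have hmain := net.ae_tendsto_sinr hL hL0 σ hNt
  have hγ := hL.gammaConst_pos
  have hLpos := hL.zero_pos
  have hc : L 0 / (2 * Real.pi * MISO.gammaConst L) ≠ 0 := by positivity
  have hq : ∀ᶠ lam : ℝ in atTop, lam / (Nt lam : ℝ) ≠ 0 := by
    filter_upwards [eventually_gt_atTop (0 : ℝ), hNt.eventually_ge_atTop 1] with lam hlam hN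
    have : (0 : ℝ) < Nt lam := by exact_mod_cast hN
    positivity
  refine ⟨hmain, fun hr => ?_, fun c hc0 hr => ?_, fun hr => ?_, fun hT => ?_⟩
  · filter_upwards [hmain] with ω hω
    refine ⟨MISO.tendsto_of_tendsto_mul hq ?_, MISO.isEquivalent_of_tendsto_mul hc hq hω⟩
    simpa using hω.mul hr.inv_tendsto_atTop
  · filter_upwards [hmain] with ω hω
    refine MISO.tendsto_of_tendsto_mul hq ?_
    have := hω.mul (hr.inv₀ hc0.ne')
    rwa [← div_eq_mul_inv, div_div] at this
  · filter_upwards [hmain] with ω hω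
    refine ⟨MISO.tendsto_of_tendsto_mul hq ?_, ?_⟩
    · have hpos : ∀ᶠ lam : ℝ in atTop, lam / (Nt lam : ℝ) ∈ Set.Ioi (0 : ℝ) := by
        filter_upwards [eventually_gt_atTop (0 : ℝ), hNt.eventually_ge_atTop 1] with lam hlam hN
        have : (0 : ℝ) < Nt lam := by exact_mod_cast hN
        exact div_pos hlam this
      exact hω.pos_mul_atTop (by positivity)
        (tendsto_nhdsWithin_iff.2 ⟨hr, hpos⟩).inv_tendsto_nhdsGT_zero
    · simpa only [inv_div] using MISO.isEquivalent_of_tendsto_mul hc hq hω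
  · obtain ⟨C, hC, lam₁, hbound⟩ := net.exists_lintegral_sinr_sq_le hL hL0 hT σ
    have hm : ∀ᶠ lam : ℝ in atTop, AEMeasurable
        (fun ω => lam / (Nt lam : ℝ) * net.sinr L σ (Nt lam) lam ω) P := by
      filter_upwards [hNt.eventually_ge_atTop 1] with lam hN
      exact (net.aemeasurable_sinr hL σ hN lam).const_mul _
    have hb : ∀ᶠ lam : ℝ in atTop, ∫⁻ ω, ENNReal.ofReal
        ((lam / (Nt lam : ℝ) * net.sinr L σ (Nt lam) lam ω) ^ 2) ∂P ≤ C := by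
      filter_upwards [eventually_ge_atTop lam₁, hNt.eventually_ge_atTop 1] with lam hlam hN
      exact hbound lam hlam _ hN
    refine ⟨?_, MISO.tendsto_integral_of_lintegral_sq_le hm ?_ hC hb hmain⟩
    · filter_upwards [hm, hb] with lam h1 h2
      exact (MISO.integrable_of_lintegral_sq_le h1 hC h2).1
    · filter_upwards [eventually_ge_atTop (0 : ℝ)] with lam hlam ω
      exact mul_nonneg (by positivity) (net.sinr_nonneg hL σ _ lam ω)
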